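/- Let $N\ge 1$ and let $(\theta_1,\dots,\theta_N)\in[0,2\pi)^N$ be the eigenangles of the circular unitary ensemble, with joint density $p(\theta_1,\dots,\theta_N)=\frac1{\mathcal Z}\prod_{1\le j<l\le N}|e^{i\theta_j}-e^{i\theta_l}|^2$, where $\mathcal Z$ is the normalization constant. Let $n(\lambda)=\sum_{j=1}^N\delta(\lambda-\theta_j)$ be the microscopic eigenvalue density, and let $N_{(3)}(\lambda,\lambda',\lambda'')=\kappa\big(n(\lambda),n(\lambda'),n(\lambda'')\big)$ be the joint cumulant of $n(\lambda)$, $n(\lambda')$, $n(\lambda'')$. It is invariant under rotations of the circle, so that $N_{(3)}(\lambda,\lambda',\lambda'')=N_{(3)}(\lambda-\lambda'',\lambda'-\lambda'',0)$ with differences taken modulo $2\pi$ in $[0,2\pi)$; this defines the generalized function $N_{(3)}(\lambda,\lambda',0)$ on $[0,2\pi)^2$, in which a term $\delta(\lambda)$ or $\delta(\lambda')$ is the unit point mass at $0$. For $k\in\mathbb R$ and $b\in\mathbb N=\{0,1,2,\dots\}$ put $$S_N^{(3)}(k,b)=\int_0^{2\pi}\!\!\int_0^{2\pi}e^{i(k\lambda+b\lambda')}\,N_{(3)}(\lambda,\lambda',0)\,d\lambda\,d\lambda'.$$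 Let $\psi_0(x)=\frac{d}{dx}\ln\Gamma(x)$ be the digamma function, and let $\Theta(x)=1$ for $x\ge0$ and $\Theta(x)=0$ for $x<0$. Then for all $b\in\mathbb N$ and $k\in\mathbb R$, $$\begin{aligned} \mathrm{Re}\,S_N^{(3)}(k,b)={}&\frac{N-\max(0,N-b)}{2\pi}+\frac{\sin(2\pi k)}{4\pi^2}\bigg(\Theta(-b+N-1)\Big(2(b+k-N)\psi_0(b+k-N+1)-2(b+k)\psi_0(b+k+1)\\ &-2k\,\psi_0(k+1)+2(k+N)\psi_0(k+N+1)\Big)-(b+k-N)\psi_0(b+k-N+1)\\ &-(b+k+N)\psi_0(b+k+N+1)-(k+N)\psi_0(k+N+1)+2(b+k)\psi_0(b+k+1)\\ &-(k-N)\psi_0(k-N+1)+2k\,\psi_0(k+1)\bigg). \end{aligned}$$ The right-hand side is literally defined unless $k$ is an integer smaller than $N$. At these integers its singularity is removable, and the right-hand side is understood as its limit there. In fact, at every real $k_0$ its limit as $k\to k_0$, $k\ne k_0$, is $\mathrm{Re}\,S_N^{(3)}(k_0,b)$. (For $k\ge 0$ one may in particular take $b=\lfloor k\rfloor$.) -/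

import Mathlib

open Filter Topology MeasureTheory

noncomputable section

/-- The half-open interval `[0, 2π)` in which angles on the unit circle are taken. -/
def angleInterval : Set ℝ := Set.Ico 0 (2 * Real.pi)

/-- The representative in `[0, 2π)` of a real number modulo `2π`. -/
def angleMod (x : ℝ) : ℝ := toIcoMod Real.two_pi_pos 0 x

/-- The unnormalised joint density `∏_{j < l} |e^{iθ_j} - e^{iθ_l}|²`. -/
def cueWeight (N : ℕ) (θ : Fin N → ℝ) : ℝ :=
  ∏ j : Fin N, ∏ l ∈ Finset.Ioi j,
    ‖Complex.exp (Complex.I * (θ j : ℂ)) - Complex.exp (Complex.I * (θ l : ℂ))‖ ^ 2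

/-- The normalisation constant. -/
def cueZ (N : ℕ) : ℝ :=
  ∫ θ in Set.univ.pi (fun _ : Fin N => angleInterval), cueWeight N θ

/-- The joint probability density of the `N` eigenangles of the circular unitary ensemble. -/
def cuePDF (N : ℕ) (θ : Fin N → ℝ) : ℝ := cueWeight N θ / cueZ N

/-- The law of the `N` eigenangles, a measure carried by `[0, 2π)^N`. -/
def cueLaw (N : ℕ) : Measure (Fin N → ℝ) :=
  (volume.restrict (Set.univ.pi (fun _ : Fin N => angleInterval))).withDensity
    (fun θ => ENNReal.ofReal (cuePDF N θ))

/-- With `n(x) = ∑ i, δ(x - θ i)` the microscopic eigenvalue density and `⟨·⟩` the ensemble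
average, the generalised function `⟨n(x)⟩` integrated against `f`. -/
def cueMoment1 (N : ℕ) (f : ℝ → ℂ) : ℂ :=
  ∫ θ, ∑ i : Fin N, f (θ i) ∂(cueLaw N)

/-- The generalised function `⟨n(x) n(y)⟩` integrated against `f`
(coinciding indices are included). -/
def cueMoment2 (N : ℕ) (f : ℝ → ℝ → ℂ) : ℂ :=
  ∫ θ, ∑ i : Fin N, ∑ j : Fin N, f (θ i) (θ j) ∂(cueLaw N)

/-- The generalised function `⟨n(x) n(y) n(z)⟩` integrated against `f`
(coinciding indices are included). -/
def cueMoment3 (N : ℕ) (f : ℝ → ℝ → ℝ → ℂ) : ℂ :=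
  ∫ θ, ∑ i : Fin N, ∑ j : Fin N, ∑ l : Fin N, f (θ i) (θ j) (θ l) ∂(cueLaw N)

/-- The triple-density correlation function, the joint cumulant
`N₃(x, y, z) = κ(n(x), n(y), n(z))
  = ⟨n(x)n(y)n(z)⟩ - ⟨n(x)n(y)⟩⟨n(z)⟩ - ⟨n(x)n(z)⟩⟨n(y)⟩ - ⟨n(y)n(z)⟩⟨n(x)⟩
    + 2⟨n(x)⟩⟨n(y)⟩⟨n(z)⟩`,
integrated against `f`, that is `∫∫∫ f(x, y, z) N₃(x, y, z) dx dy dz`. -/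
def cueCumulant3 (N : ℕ) (f : ℝ → ℝ → ℝ → ℂ) : ℂ :=
  cueMoment3 N f
    - cueMoment2 N (fun x y => cueMoment1 N (fun z => f x y z))
    - cueMoment2 N (fun x z => cueMoment1 N (fun y => f x y z))
    - cueMoment2 N (fun y z => cueMoment1 N (fun x => f x y z))
    + 2 * cueMoment1 N (fun x => cueMoment1 N (fun y => cueMoment1 N (fun z => f x y z)))

/-- The generalised function `N₃(x, y, 0)` on `[0, 2π)²` integrated against `g`, that is
`∫∫ g(x, y) N₃(x, y, 0) dx dy`.

`N₃` is invariant under rotations of the circle, `N₃(x, y, z) = N₃(x - z, y - z, 0)`, which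
determines the generalised function `N₃(·, ·, 0)`: integrating
`g(x - z, y - z) N₃(x, y, z)` over `x, y, z` gives `2π ∫∫ g(x, y) N₃(x, y, 0) dx dy`, all
differences being taken modulo `2π` in `[0, 2π)`.  In particular a term `δ(x)` of
`N₃(x, y, 0)` acts as the unit point mass at the left end point `0` of `[0, 2π)`. -/
def cueCumulant3AtZero (N : ℕ) (g : ℝ → ℝ → ℂ) : ℂ :=
  1 / (2 * (Real.pi : ℂ)) *
    cueCumulant3 N (fun x y z => g (angleMod (x - z)) (angleMod (y - z)))

/-- The third-order spectral form factor
`S_N⁽³⁾(k, b) = ∫₀^{2π} ∫₀^{2π} e^{i(kx + by)} N₃(x, y, 0) dx dy`. -/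
def thirdOrderSFF (N : ℕ) (k : ℝ) (b : ℕ) : ℂ :=
  cueCumulant3AtZero N
    (fun x y => Complex.exp (Complex.I * ((k : ℂ) * (x : ℂ) + (b : ℂ) * (y : ℂ))))

/-- The digamma function `ψ₀(x) = d/dx ln Γ(x)` (`Real.log` is `ln |·|`, so that
`ψ₀ = Γ'/Γ` also where `Γ` is negative). -/
def psi0 (x : ℝ) : ℝ := deriv (fun t : ℝ => Real.log (Real.Gamma t)) x

/-- The unit step function, equal to `1` for `x ≥ 0` and to `0` for `x < 0`. -/
def unitStep (x : ℝ) : ℝ := if 0 ≤ x then 1 else 0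

/-- The closed form for the real part of the third-order spectral form factor. -/
def thirdOrderClosedForm (N : ℕ) (b : ℕ) (k : ℝ) : ℝ :=
  ((N : ℝ) - max 0 ((N : ℝ) - (b : ℝ))) / (2 * Real.pi)
    + Real.sin (2 * Real.pi * k) / (4 * Real.pi ^ 2) *
      (unitStep (-(b : ℝ) + (N : ℝ) - 1) *
          (2 * (b + k - N) * psi0 (b + k - N + 1)
            - 2 * (b + k) * psi0 (b + k + 1)
            - 2 * k * psi0 (k + 1)
            + 2 * (k + N) * psi0 (k + N + 1))
        - (b + k - N) * psi0 (b + k - N + 1)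
        - (b + k + N) * psi0 (b + k + N + 1)
        - (k + N) * psi0 (k + N + 1)
        + 2 * (b + k) * psi0 (b + k + 1)
        - (k - N) * psi0 (k - N + 1)
        + 2 * k * psi0 (k + 1))

end

/-! Write E(κ) for the mean of e^{iκu} over [0, 2π) (`modeMean`). The squared Vandermonde modulus is
a double sum over permutations of products of integer modes, so orthogonality gives the
determinantal structure: averages over r distinct eigenangles are sums over m ∈ {0, …, N-1}^r of
integrals against r × r determinants of modes (`integral_cueLaw_sum_embedding`).

Tested against e^{ik(x-z)} e^{ib(y-z)}, every moment becomes a finite sum of products of values of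
E. Splitting index sums by coincidences and subtracting the disconnected products leaves the
3-cycles, three pair sums and N (`cueCumulant3_expMode`). Since b is an integer, E(b + p) is a
Kronecker delta; it collapses the triple sum to double sums of E(x + j - p) over rectangles
(`cycleSum_eq_boxSum`).

The real part of E(κ) is sinc(2πκ), and integer shifts do not change sin(2πx). For non-integer x a
rectangle sum is therefore sin(2πx)/2π times a double sum of 1/(x + j - p), which telescopes twice
through ψ₀(x + 1) = ψ₀(x) + 1/x (`sum_sum_one_div`). This proves the formula off the integers. The
finite sums of sinc are continuous in k, which gives the limit at every point; at integers k ≥ N all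
four rectangle sums vanish, as does the sine prefactor. -/

noncomputable section

/-! ### Fourier modes on the circle. -/

/-- Lebesgue measure on `[0, 2π)`. -/
def angleVol : Measure ℝ := volume.restrict angleInterval

instance isFiniteMeasure_angleVol : IsFiniteMeasure angleVol := by
  unfold angleVol angleInterval
  infer_instance

/-- The exponential `u ↦ e^{iκu}`. -/
def expMode (κ u : ℝ) : ℂ := Complex.exp (Complex.I * ((κ : ℂ) * (u : ℂ)))

/-- The mean of `e^{iκu}` over `[0, 2π)`. -/
def modeMean (κ : ℝ) : ℂ := 1 / (2 * (Real.pi : ℂ)) * ∫ u, expMode κ u ∂angleVol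

lemma expMode_add_left (κ μ u : ℝ) : expMode (κ + μ) u = expMode κ u * expMode μ u := by
  unfold expMode
  rw [← Complex.exp_add]
  push_cast
  ring_nf

lemma expMode_add_right (κ u v : ℝ) : expMode κ (u + v) = expMode κ u * expMode κ v := by
  unfold expMode
  rw [← Complex.exp_add]
  push_cast
  ring_nf

@[simp] lemma expMode_zero_left (u : ℝ) : expMode 0 u = 1 := by simp [expMode]

@[simp] lemma expMode_zero_right (κ : ℝ) : expMode κ 0 = 1 := by simp [expMode]

lemma expMode_neg_right (κ u : ℝ) : expMode κ (-u) = expMode (-κ) u := by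
  simp [expMode]

lemma norm_expMode (κ u : ℝ) : ‖expMode κ u‖ = 1 := by
  unfold expMode
  rw [mul_comm, ← Complex.ofReal_mul, Complex.norm_exp_ofReal_mul_I]

lemma continuous_expMode (κ : ℝ) : Continuous (expMode κ) := by
  unfold expMode
  fun_prop

@[fun_prop]
lemma measurable_expMode (κ : ℝ) : Measurable (expMode κ) := (continuous_expMode κ).measurable

@[fun_prop]
lemma measurable_angleMod : Measurable angleMod := by
  have h : angleMod = fun x => Int.fract ((x - 0) / (2 * Real.pi)) * (2 * Real.pi) := by
    funext x
    unfold angleMod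
    rw [toIcoMod_eq_add_fract_mul, zero_add]
  rw [h]
  exact (measurable_fract.comp (by fun_prop)).mul_const _

lemma expMode_int_add_period (p : ℤ) (u : ℝ) : expMode p (u + 2 * Real.pi) = expMode p u := by
  rw [expMode_add_right]
  have : expMode p (2 * Real.pi) = 1 := by
    unfold expMode
    rw [Complex.exp_eq_one_iff]
    exact ⟨p, by push_cast; ring⟩
  rw [this, mul_one]

/-- Integer frequencies do not see the reduction modulo 2π. This applies to b but not to the real
frequency k, whose mode jumps at the end of the interval. -/
lemma expMode_int_angleMod (p : ℤ) (x : ℝ) : expMode p (angleMod x) = expMode p x := by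
  have h : Function.Periodic (expMode p) (2 * Real.pi) := expMode_int_add_period p
  unfold angleMod toIcoMod
  exact h.sub_zsmul_eq _

@[simp] lemma angleMod_zero : angleMod 0 = 0 := by
  unfold angleMod
  exact toIcoMod_apply_left Real.two_pi_pos 0

lemma angleMod_of_mem {u : ℝ} (hu : u ∈ angleInterval) : angleMod u = u := by
  unfold angleMod
  rw [toIcoMod_eq_self]
  simpa [angleInterval] using hu

lemma integral_angleVol (f : ℝ → ℂ) :
    ∫ u, f u ∂angleVol = ∫ u in (0 : ℝ)..(0 + 2 * Real.pi), f u := by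
  rw [intervalIntegral.integral_of_le (by linarith [Real.two_pi_pos]),
    ← integral_Ico_eq_integral_Ioc, zero_add]
  rfl

lemma integral_one_angleVol : (∫ _u, (1 : ℂ) ∂angleVol) = 2 * (Real.pi : ℂ) := by
  rw [integral_angleVol]
  simp

lemma two_pi_ne_zero' : (2 * (Real.pi : ℂ)) ≠ 0 := by
  simp [Real.pi_ne_zero]

lemma integral_expMode (κ : ℝ) :
    ∫ u, expMode κ u ∂angleVol = 2 * (Real.pi : ℂ) * modeMean κ := by
  unfold modeMean
  field_simp [two_pi_ne_zero']

lemma modeMean_zero : modeMean 0 = 1 := by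
  unfold modeMean
  simp only [expMode_zero_left]
  rw [integral_one_angleVol]
  field_simp [two_pi_ne_zero']

lemma integral_expMode_of_ne {κ : ℝ} (h : κ ≠ 0) :
    ∫ u, expMode κ u ∂angleVol
      = (Complex.exp (Complex.I * (κ * (2 * Real.pi))) - 1) / (Complex.I * κ) := by
  have hc : Complex.I * (κ : ℂ) ≠ 0 := by simp [h]
  rw [integral_angleVol]
  have := integral_exp_mul_complex (a := 0) (b := 0 + 2 * Real.pi) hc
  simp only [expMode, ← mul_assoc]
  rw [this]
  simp [mul_assoc]

lemma modeMean_int (p : ℤ) : modeMean p = if p = 0 then 1 else 0 := by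
  split_ifs with h
  · rw [h, Int.cast_zero, modeMean_zero]
  · have hp : (p : ℝ) ≠ 0 := by exact_mod_cast h
    unfold modeMean
    rw [integral_expMode_of_ne hp]
    have : Complex.exp (Complex.I * (((p : ℝ) : ℂ) * (2 * Real.pi))) = 1 := by
      rw [Complex.exp_eq_one_iff]
      exact ⟨p, by push_cast; ring⟩
    rw [this]
    simp

lemma re_modeMean (κ : ℝ) : (modeMean κ).re = Real.sinc (2 * Real.pi * κ) := by
  by_cases h : κ = 0
  · rw [h, modeMean_zero]; simp
  · have hk : 2 * Real.pi * κ ≠ 0 := by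
      have := Real.pi_ne_zero
      positivity
    rw [Real.sinc_of_ne_zero hk]
    unfold modeMean
    rw [integral_expMode_of_ne h]
    have e : Complex.exp (Complex.I * (κ * (2 * Real.pi)))
        = (Real.cos (2 * Real.pi * κ) : ℂ) + (Real.sin (2 * Real.pi * κ) : ℂ) * Complex.I := by
      rw [show Complex.I * ((κ : ℂ) * (2 * Real.pi))
        = ((2 * Real.pi * κ : ℝ) : ℂ) * Complex.I by push_cast; ring]
      rw [Complex.exp_mul_I, Complex.ofReal_cos, Complex.ofReal_sin]
    rw [e]
    have hk' : (κ : ℂ) ≠ 0 := by exact_mod_cast h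
    have : 1 / (2 * (Real.pi : ℂ)) * (((Real.cos (2 * Real.pi * κ) : ℂ)
        + (Real.sin (2 * Real.pi * κ) : ℂ) * Complex.I - 1) / (Complex.I * κ))
        = ((Real.sin (2 * Real.pi * κ) / (2 * Real.pi * κ) : ℝ) : ℂ)
          + ((-(Real.cos (2 * Real.pi * κ) - 1) / (2 * Real.pi * κ) : ℝ) : ℂ) * Complex.I := by
      have h2 := two_pi_ne_zero'
      have h3 : (Real.pi : ℂ) ≠ 0 := by simp [Real.pi_ne_zero]
      push_cast
      field_simp
      ring_nf
      simp only [Complex.I_sq]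
      ring
    rw [this, Complex.add_re, Complex.ofReal_re, Complex.re_ofReal_mul, Complex.I_re, mul_zero,
      add_zero]

/-- Rotation invariance: `Φ ∘ angleMod` is periodic whatever Φ is, so its integral over any full
period is the same. -/
lemma integral_angleMod_sub (Φ : ℝ → ℂ) (z : ℝ) :
    ∫ x, Φ (angleMod (x - z)) ∂angleVol = ∫ u, Φ u ∂angleVol := by
  have hper : Function.Periodic (fun x => Φ (angleMod x)) (2 * Real.pi) := fun x => by
    simp only [angleMod, toIcoMod_periodic Real.two_pi_pos 0 x]
  rw [integral_angleVol,
    intervalIntegral.integral_comp_sub_right (fun x => Φ (angleMod x)) z,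
    show (0 + 2 * Real.pi - z) = (0 - z) + 2 * Real.pi by ring,
    hper.intervalIntegral_add_eq (0 - z) 0, ← integral_angleVol]
  refine setIntegral_congr_fun measurableSet_Ico fun u hu => ?_
  simp only [angleMod_of_mem hu]

lemma integral_angleMod_sub_left (Φ : ℝ → ℂ) (x : ℝ) :
    ∫ z, Φ (angleMod (x - z)) ∂angleVol = ∫ u, Φ u ∂angleVol := by
  have hper : Function.Periodic (fun x => Φ (angleMod x)) (2 * Real.pi) := fun x => by
    simp only [angleMod, toIcoMod_periodic Real.two_pi_pos 0 x]
  rw [integral_angleVol,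
    intervalIntegral.integral_comp_sub_left (fun x => Φ (angleMod x)) x,
    show x - 0 = (x - (0 + 2 * Real.pi)) + 2 * Real.pi by ring,
    hper.intervalIntegral_add_eq (x - (0 + 2 * Real.pi)) 0, ← integral_angleVol]
  refine setIntegral_congr_fun measurableSet_Ico fun u hu => ?_
  simp only [angleMod_of_mem hu]

/-! ### Determinantal structure of the ensemble. -/

/-- The squared modulus of the Vandermonde determinant as a double sum over permutations. -/
lemma cueWeight_eq_sum (N : ℕ) (θ : Fin N → ℝ) :
    (cueWeight N θ : ℂ) = ∑ σ : Equiv.Perm (Fin N), ∑ τ : Equiv.Perm (Fin N),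
      ((Equiv.Perm.sign σ : ℤ) : ℂ) * ((Equiv.Perm.sign τ : ℤ) : ℂ) *
        ∏ j, expMode (((σ j : ℕ) : ℝ) - ((τ j : ℕ) : ℝ)) (θ j) := by
  set v : Fin N → ℂ := fun j => expMode 1 (θ j) with hv
  have hw : cueWeight N θ = ‖(Matrix.vandermonde v).det‖ ^ 2 := by
    rw [Matrix.det_vandermonde, norm_prod, ← Finset.prod_pow]
    unfold cueWeight
    refine Finset.prod_congr rfl fun j _ => ?_
    rw [norm_prod, ← Finset.prod_pow]
    refine Finset.prod_congr rfl fun l _ => ?_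
    rw [norm_sub_rev]
    simp [hv, expMode]
  have hpow : ∀ (n : ℕ) (j : Fin N), v j ^ n = expMode n (θ j) := fun n j => by
    simp only [hv, expMode]
    rw [← Complex.exp_nat_mul]
    push_cast
    ring_nf
  have hdet : (Matrix.vandermonde v).det = ∑ σ : Equiv.Perm (Fin N),
      ((Equiv.Perm.sign σ : ℤ) : ℂ) * ∏ j, expMode ((σ j : ℕ) : ℝ) (θ j) := by
    rw [← Matrix.det_transpose, Matrix.det_apply']
    refine Finset.sum_congr rfl fun σ _ => ?_
    simp [Matrix.transpose_apply, Matrix.vandermonde_apply, hpow]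
  have hconj : (starRingEnd ℂ) (Matrix.vandermonde v).det = ∑ τ : Equiv.Perm (Fin N),
      ((Equiv.Perm.sign τ : ℤ) : ℂ) * ∏ j, expMode (-((τ j : ℕ) : ℝ)) (θ j) := by
    rw [hdet, map_sum]
    refine Finset.sum_congr rfl fun τ _ => ?_
    rw [map_mul, map_prod, map_intCast]
    congr 1
    refine Finset.prod_congr rfl fun j _ => ?_
    simp only [expMode, ← Complex.exp_conj, map_mul, Complex.conj_I, Complex.conj_ofReal]
    congr 1
    push_cast
    ring
  rw [hw]
  push_cast
  rw [← Complex.mul_conj', hconj, hdet, Finset.sum_mul_sum]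
  refine Finset.sum_congr rfl fun σ _ => Finset.sum_congr rfl fun τ _ => ?_
  rw [mul_mul_mul_comm, ← Finset.prod_mul_distrib]
  simp only [sub_eq_add_neg, expMode_add_left]

/-- Averages over the circular unitary ensemble as integrals against the weight. -/
lemma integral_cueLaw (N : ℕ) (F : (Fin N → ℝ) → ℂ) :
    ∫ θ, F θ ∂(cueLaw N)
      = (cueZ N : ℂ)⁻¹ * ∫ θ, (cueWeight N θ : ℂ) * F θ ∂(Measure.pi fun _ => angleVol) := by
  have hmeas : (volume : Measure (Fin N → ℝ)).restrict
      (Set.univ.pi (fun _ : Fin N => angleInterval)) = Measure.pi fun _ => angleVol :=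
    Measure.restrict_pi_pi _ _
  have hnn : ∀ θ, 0 ≤ cueWeight N θ := fun θ => by unfold cueWeight; positivity
  have hZ : 0 ≤ cueZ N := integral_nonneg fun θ => hnn θ
  have hcont : Continuous (cueWeight N) := by unfold cueWeight; fun_prop
  unfold cueLaw
  rw [hmeas, integral_withDensity_eq_integral_toReal_smul]
  · rw [← integral_const_mul]
    refine integral_congr_ae (Eventually.of_forall fun θ => ?_)
    simp only
    rw [ENNReal.toReal_ofReal (by unfold cuePDF; exact div_nonneg (hnn θ) hZ)]
    unfold cuePDF
    rw [Complex.real_smul]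
    push_cast
    ring
  · unfold cuePDF
    exact (hcont.measurable.div_const _).ennreal_ofReal
  · exact Eventually.of_forall fun θ => ENNReal.ofReal_lt_top

lemma cueZ_eq_integral (N : ℕ) :
    (cueZ N : ℂ) = ∫ θ, (cueWeight N θ : ℂ) ∂(Measure.pi fun _ => angleVol) := by
  have hmeas : (volume : Measure (Fin N → ℝ)).restrict
      (Set.univ.pi (fun _ : Fin N => angleInterval)) = Measure.pi fun _ => angleVol :=
    Measure.restrict_pi_pi _ _
  unfold cueZ
  rw [hmeas]
  exact integral_complex_ofReal.symm

/-- Integrating out the coordinates outside the range of `ι`. -/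
lemma integral_pi_embedding {r N : ℕ} (μ : Measure ℝ) [SigmaFinite μ] (ι : Fin r ↪ Fin N)
    (f : (Fin r → ℝ) → ℂ) (χ : Fin N → ℝ → ℂ) :
    ∫ θ, f (fun s => θ (ι s)) * ∏ j, χ j (θ j) ∂(Measure.pi fun _ => μ)
      = (∫ x, f x * ∏ s, χ (ι s) (x s) ∂(Measure.pi fun _ => μ))
        * ∏ j : {j // j ∉ Set.range ι}, ∫ u, χ j u ∂μ := by
  classical
  let e : Fin r ⊕ {j // j ∉ Set.range ι} ≃ Fin N :=
    (Equiv.sumCongr (Equiv.ofInjective ι ι.injective) (Equiv.refl _)).trans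
      (Equiv.sumCompl (· ∈ Set.range ι))
  have hel : ∀ s, e (Sum.inl s) = ι s := fun s => rfl
  have her : ∀ j : {j // j ∉ Set.range ι}, e (Sum.inr j) = j := fun j => rfl
  have h1 := measurePreserving_piCongrLeft (α := fun _ : Fin N => ℝ) (fun _ => μ) e
  have h2 := measurePreserving_sumPiEquivProdPi_symm
    (X := fun _ : Fin r ⊕ {j // j ∉ Set.range ι} => ℝ) (fun _ => μ)
  rw [← h1.integral_comp', ← h2.integral_comp', ← integral_fintype_prod_eq_prod,
    ← integral_prod_mul]
  refine integral_congr_ae (Eventually.of_forall fun z => ?_)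
  obtain ⟨x, y⟩ := z
  set w : Fin r ⊕ {j // j ∉ Set.range ι} → ℝ :=
    (MeasurableEquiv.sumPiEquivProdPi fun _ => ℝ).symm (x, y) with hw
  have hT : ∀ a, (MeasurableEquiv.piCongrLeft (fun _ : Fin N => ℝ) e) w (e a) = w a := fun a =>
    Equiv.piCongrLeft_apply_apply (fun _ : Fin N => ℝ) e w a
  have hl : ∀ s, (MeasurableEquiv.piCongrLeft (fun _ : Fin N => ℝ) e) w (ι s) = x s := fun s => by
    rw [← hel, hT]; rfl
  have hr : ∀ j : {j // j ∉ Set.range ι},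
      (MeasurableEquiv.piCongrLeft (fun _ : Fin N => ℝ) e) w j = y j := fun j => by
    rw [← her, hT]; rfl
  simp only [← hw, hl]
  rw [← Equiv.prod_comp e, Fintype.prod_sum_type]
  simp only [hel, her, hl, hr]
  ring

/-- Orthogonality: a coordinate off the range contributes 2π if σ and τ agree there and 0 otherwise.
The factor (2π)^r fills the exponent N - r up to N. -/
lemma prod_integral_expMode_compl {r N : ℕ} (ι : Fin r ↪ Fin N) (σ τ : Equiv.Perm (Fin N)) :
    (∏ j : {j // j ∉ Set.range ι},
        ∫ u, expMode (((σ j : ℕ) : ℝ) - ((τ j : ℕ) : ℝ)) u ∂angleVol) * (2 * (Real.pi : ℂ)) ^ r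
      = if ∀ j, j ∉ Set.range ι → σ j = τ j then (2 * (Real.pi : ℂ)) ^ N else 0 := by
  classical
  have hint : ∀ j : Fin N, (∫ u, expMode (((σ j : ℕ) : ℝ) - ((τ j : ℕ) : ℝ)) u ∂angleVol)
      = if σ j = τ j then 2 * (Real.pi : ℂ) else 0 := fun j => by
    have : (((σ j : ℕ) : ℝ) - ((τ j : ℕ) : ℝ)) = (((σ j : ℕ) - (τ j : ℕ) : ℤ) : ℝ) := by
      push_cast; ring
    rw [this, integral_expMode, modeMean_int]
    have h : (((σ j : ℕ) : ℤ) - ((τ j : ℕ) : ℤ) = 0) ↔ σ j = τ j := by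
      rw [sub_eq_zero, Nat.cast_inj, Fin.val_inj]
    simp only [h]
    split_ifs <;> simp
  simp only [hint]
  split_ifs with h
  · rw [Finset.prod_congr rfl (g := fun _ => 2 * (Real.pi : ℂ)) fun j _ => if_pos (h j.1 j.property)]
    rw [Finset.prod_const, ← pow_add]
    congr 1
    have h1 := Fintype.card_subtype_compl (fun j => j ∈ Set.range ι)
    have h2 : Fintype.card {j // j ∈ Set.range ι} = r := by
      rw [← Fintype.card_congr (Equiv.ofInjective ι ι.injective), Fintype.card_fin]
    have h3 : r ≤ N := by simpa using Fintype.card_le_of_embedding ι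
    rw [Finset.card_univ]
    simp only [Fintype.card_fin] at h1
    rw [h1, h2]
    omega
  · push Not at h
    obtain ⟨j, hj, hne⟩ := h
    rw [Finset.prod_eq_zero (Finset.mem_univ (⟨j, hj⟩ : {j // j ∉ Set.range ι})) (if_neg hne),
      zero_mul]

/-- Permutations agreeing with `σ` off the range of `ι` differ from it by a permutation of the
domain of `ι`. -/
lemma sum_perm_eq_off_range {r N : ℕ} (ι : Fin r ↪ Fin N) (σ : Equiv.Perm (Fin N))
    (g : Equiv.Perm (Fin N) → ℂ) :
    (∑ τ : Equiv.Perm (Fin N), if ∀ j, j ∉ Set.range ι → σ j = τ j then g τ else 0)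
      = ∑ ρ : Equiv.Perm (Fin r), g (σ * ρ.viaFintypeEmbedding ι) := by
  classical
  rw [← Finset.sum_filter]
  symm
  refine Finset.sum_bij (fun ρ _ => σ * ρ.viaFintypeEmbedding ι) ?_ ?_ ?_ ?_
  · intro ρ _
    simp only [Finset.mem_filter, Finset.mem_univ, true_and]
    intro j hj
    rw [Equiv.Perm.mul_apply, Equiv.Perm.viaFintypeEmbedding_apply_notMem_range _ _ hj]
  · intro ρ₁ _ ρ₂ _ h
    have h' := mul_left_cancel h
    ext s
    have := congrArg (fun π : Equiv.Perm (Fin N) => π (ι s)) h'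
    simp only [Equiv.Perm.viaFintypeEmbedding_apply_image] at this
    rw [ι.injective this]
  · intro τ hτ
    simp only [Finset.mem_filter, Finset.mem_univ, true_and] at hτ
    -- This permutation fixes the complement of the range pointwise, hence maps the range to itself;
    -- `q` is its restriction, read on `Fin r`.
    set π : Equiv.Perm (Fin N) := σ⁻¹ * τ with hπ
    have hfix : ∀ j, j ∉ Set.range ι → π j = j := fun j hj => by
      rw [hπ, Equiv.Perm.mul_apply, ← hτ j hj, ← Equiv.Perm.mul_apply, inv_mul_cancel, Equiv.Perm.one_apply]
    have hmem : ∀ j, j ∈ Set.range ι → π j ∈ Set.range ι := fun j hj => by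
      by_contra hn
      have := hfix _ hn
      exact hn (by rwa [π.injective this])
    choose q hq using fun s => hmem (ι s) ⟨s, rfl⟩
    have hinj : Function.Injective q := fun s t hst => by
      apply ι.injective
      apply π.injective
      rw [← hq, ← hq, hst]
    refine ⟨Equiv.ofBijective q (Finite.injective_iff_bijective.mp hinj), Finset.mem_univ _, ?_⟩
    rw [← mul_inv_cancel_left σ τ, ← hπ]
    congr 1
    ext j
    congr 1
    by_cases hj : j ∈ Set.range ι
    · obtain ⟨s, rfl⟩ := hj
      rw [Equiv.Perm.viaFintypeEmbedding_apply_image, ← hq]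
      rfl
    · rw [Equiv.Perm.viaFintypeEmbedding_apply_notMem_range _ _ hj, hfix j hj]
  · intro ρ _
    rfl

/-- The matrix of exponentials whose determinants sum to the correlation functions. -/
def modeMatrix {r N : ℕ} (m : Fin r → Fin N) (x : Fin r → ℝ) : Matrix (Fin r) (Fin r) ℂ :=
  Matrix.of fun t s => expMode (((m s : ℕ) : ℝ) - ((m t : ℕ) : ℝ)) (x s)

lemma det_modeMatrix {r N : ℕ} (m : Fin r → Fin N) (x : Fin r → ℝ) :
    (modeMatrix m x).det = ∑ ρ : Equiv.Perm (Fin r), ((Equiv.Perm.sign ρ : ℤ) : ℂ) *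
      ∏ s, expMode (((m s : ℕ) : ℝ) - ((m (ρ s) : ℕ) : ℝ)) (x s) := by
  rw [Matrix.det_apply']
  rfl

/-- A repeated value of `m` gives two equal rows, so sums over embeddings extend freely to sums over
all functions. -/
lemma det_modeMatrix_of_not_injective {r N : ℕ} {m : Fin r → Fin N}
    (hm : ¬ Function.Injective m) (x : Fin r → ℝ) : (modeMatrix m x).det = 0 := by
  unfold Function.Injective at hm
  push Not at hm
  obtain ⟨s, t, hst, hne⟩ := hm
  refine Matrix.det_zero_of_row_eq hne ?_
  ext u
  simp [modeMatrix, hst]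

lemma sum_embedding_eq_sum {r N : ℕ} (g : (Fin r → Fin N) → ℂ)
    (hg : ∀ m, ¬ Function.Injective m → g m = 0) :
    ∑ ι : Fin r ↪ Fin N, g ι = ∑ m : Fin r → Fin N, g m := by
  classical
  rw [← Finset.sum_filter_of_ne (s := Finset.univ) (p := Function.Injective)
    (fun m _ h => by_contra fun hn => h (hg m hn))]
  refine Finset.sum_bij (fun ι _ => ι) (fun ι _ => by simp [ι.injective])
    (fun a _ b _ h => DFunLike.coe_injective h)
    (fun m hm => ⟨⟨m, (Finset.mem_filter.mp hm).2⟩, Finset.mem_univ _, rfl⟩) fun _ _ => rfl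

lemma norm_prod_expMode {ι : Type*} [Fintype ι] (a : ι → ℝ) (x : ι → ℝ) :
    ‖∏ s, expMode (a s) (x s)‖ = 1 := by
  rw [norm_prod]
  simp [norm_expMode]

@[fun_prop]
lemma measurable_prod_expMode {ι : Type*} [Fintype ι] (a : ι → ℝ) :
    Measurable fun x : ι → ℝ => ∏ s, expMode (a s) (x s) :=
  Finset.measurable_fun_prod _ fun s _ => (measurable_expMode (a s)).comp (measurable_pi_apply s)

lemma integrable_of_measurable_of_bound {α : Type*} [MeasurableSpace α] {μ : Measure α}
    [IsFiniteMeasure μ] {f : α → ℂ} (hf : Measurable f) {C : ℝ} (hC : ∀ x, ‖f x‖ ≤ C) :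
    Integrable f μ :=
  Integrable.of_bound hf.aestronglyMeasurable C (Eventually.of_forall hC)

lemma integrable_mul_prod_expMode {r : ℕ} {f : (Fin r → ℝ) → ℂ} (hf : Measurable f) {C : ℝ}
    (hC : ∀ x, ‖f x‖ ≤ C) (a : Fin r → ℝ) :
    Integrable (fun x => f x * ∏ s, expMode (a s) (x s)) (Measure.pi fun _ => angleVol) := by
  refine integrable_of_measurable_of_bound (hf.mul (measurable_prod_expMode a)) (C := C) fun x => ?_
  rw [norm_mul, norm_prod_expMode, mul_one]
  exact hC x

/-- The signature of a permutation as a complex number. -/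
def permSign {n : ℕ} (σ : Equiv.Perm (Fin n)) : ℂ := ((Equiv.Perm.sign σ : ℤ) : ℂ)

/-- The determinantal structure of the ensemble: unnormalised `r`-point averages over distinct
indices. -/
lemma integral_weight_sum_embedding {r : ℕ} (N : ℕ) {f : (Fin r → ℝ) → ℂ} (hf : Measurable f)
    {C : ℝ} (hC : ∀ x, ‖f x‖ ≤ C) :
    (2 * (Real.pi : ℂ)) ^ r * ∫ θ, (cueWeight N θ : ℂ) *
        ∑ ι : Fin r ↪ Fin N, f (fun s => θ (ι s)) ∂(Measure.pi fun _ => angleVol)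
      = (N.factorial : ℂ) * (2 * (Real.pi : ℂ)) ^ N * ∑ m : Fin r → Fin N,
          ∫ x, f x * (modeMatrix m x).det ∂(Measure.pi fun _ => angleVol) := by
  classical
  set I : (Fin r → ℝ) → ℂ := fun a =>
    ∫ x, f x * ∏ s, expMode (a s) (x s) ∂(Measure.pi fun _ => angleVol) with hI
  have hdet : ∀ m : Fin r → Fin N,
      ∫ x, f x * (modeMatrix m x).det ∂(Measure.pi fun _ => angleVol)
        = ∑ ρ : Equiv.Perm (Fin r), permSign ρ * I (fun s => ((m s : ℕ) : ℝ) - ((m (ρ s) : ℕ) : ℝ)) := by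
    intro m
    simp only [det_modeMatrix, Finset.mul_sum, hI, ← integral_const_mul]
    rw [integral_finsetSum]
    · refine Finset.sum_congr rfl fun ρ _ => integral_congr_ae (Eventually.of_forall fun x => ?_)
      simp only [permSign]
      ring
    · intro ρ _
      have := (integrable_mul_prod_expMode hf hC
        (fun s => ((m s : ℕ) : ℝ) - ((m (ρ s) : ℕ) : ℝ))).const_mul (permSign ρ)
      refine this.congr (Eventually.of_forall fun x => ?_)
      simp only [permSign]
      ring
  have hexp : ∀ θ : Fin N → ℝ, (cueWeight N θ : ℂ) * ∑ ι : Fin r ↪ Fin N, f (fun s => θ (ι s))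
      = ∑ ι : Fin r ↪ Fin N, ∑ σ : Equiv.Perm (Fin N), ∑ τ : Equiv.Perm (Fin N),
        (permSign σ * permSign τ) * (f (fun s => θ (ι s)) *
          ∏ j, expMode (((σ j : ℕ) : ℝ) - ((τ j : ℕ) : ℝ)) (θ j)) := by
    intro θ
    rw [cueWeight_eq_sum, Finset.mul_sum]
    refine Finset.sum_congr rfl fun ι _ => ?_
    simp only [Finset.sum_mul]
    refine Finset.sum_congr rfl fun σ _ => Finset.sum_congr rfl fun τ _ => ?_
    simp only [permSign]
    ring
  have hint : ∀ (ι : Fin r ↪ Fin N) (σ τ : Equiv.Perm (Fin N)),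
      Integrable (fun θ : Fin N → ℝ => (permSign σ * permSign τ) * (f (fun s => θ (ι s)) *
          ∏ j, expMode (((σ j : ℕ) : ℝ) - ((τ j : ℕ) : ℝ)) (θ j)))
        (Measure.pi fun _ => angleVol) := fun ι σ τ => by
    refine (integrable_mul_prod_expMode (f := fun θ => f (fun s => θ (ι s)))
      (hf.comp (measurable_pi_lambda _ fun s => measurable_pi_apply _))
      (fun θ => hC _) _).const_mul _
  simp only [hexp]
  rw [integral_finsetSum _ fun ι _ => integrable_finsetSum _ fun σ _ =>
    integrable_finsetSum _ fun τ _ => hint ι σ τ]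
  -- Integrating out the unused coordinates forces τ = σρ with ρ permuting the r chosen indices; the
  -- sum over ρ is then a Leibniz expansion.
  have hterm : ∀ (ι : Fin r ↪ Fin N) (σ : Equiv.Perm (Fin N)),
      (2 * (Real.pi : ℂ)) ^ r * ∫ θ, ∑ τ : Equiv.Perm (Fin N), (permSign σ * permSign τ) *
          (f (fun s => θ (ι s)) * ∏ j, expMode (((σ j : ℕ) : ℝ) - ((τ j : ℕ) : ℝ)) (θ j))
          ∂(Measure.pi fun _ => angleVol)
        = (2 * (Real.pi : ℂ)) ^ N * ∫ x, f x * (modeMatrix (fun s => σ (ι s)) x).det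
            ∂(Measure.pi fun _ => angleVol) := by
    intro ι σ
    rw [integral_finsetSum _ fun τ _ => hint ι σ τ, hdet, Finset.mul_sum, Finset.mul_sum]
    have h1 : ∀ τ : Equiv.Perm (Fin N), (2 * (Real.pi : ℂ)) ^ r * ∫ θ, (permSign σ * permSign τ) *
          (f (fun s => θ (ι s)) * ∏ j, expMode (((σ j : ℕ) : ℝ) - ((τ j : ℕ) : ℝ)) (θ j))
          ∂(Measure.pi fun _ => angleVol)
        = if ∀ j, j ∉ Set.range ι → σ j = τ j then (permSign σ * permSign τ) *
          I (fun s => ((σ (ι s) : ℕ) : ℝ) - ((τ (ι s) : ℕ) : ℝ)) * (2 * (Real.pi : ℂ)) ^ N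
          else 0 := fun τ => by
      rw [integral_const_mul, integral_pi_embedding angleVol ι f
        (fun j => expMode (((σ j : ℕ) : ℝ) - ((τ j : ℕ) : ℝ)))]
      have := prod_integral_expMode_compl ι σ τ
      rw [show ∀ A B C D : ℂ, A * (B * (C * D)) = B * C * (D * A) by intros; ring, this]
      split_ifs <;> simp [hI]
    simp only [h1]
    rw [sum_perm_eq_off_range ι σ (fun τ => (permSign σ * permSign τ) *
          I (fun s => ((σ (ι s) : ℕ) : ℝ) - ((τ (ι s) : ℕ) : ℝ)) * (2 * (Real.pi : ℂ)) ^ N)]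
    refine Finset.sum_congr rfl fun ρ _ => ?_
    have hsign : permSign σ * permSign (σ * ρ.viaFintypeEmbedding ι) = permSign ρ := by
      simp only [permSign]
      rw [Equiv.Perm.sign_mul, Equiv.Perm.viaFintypeEmbedding_sign, ← Int.cast_mul,
        ← Units.val_mul, ← mul_assoc, Int.units_mul_self, one_mul]
    rw [hsign]
    simp only [Equiv.Perm.mul_apply, Equiv.Perm.viaFintypeEmbedding_apply_image]
    ring
  have hinner : ∀ ι : Fin r ↪ Fin N, (2 * (Real.pi : ℂ)) ^ r *
      ∫ θ, ∑ σ : Equiv.Perm (Fin N), ∑ τ : Equiv.Perm (Fin N), (permSign σ * permSign τ) *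
          (f (fun s => θ (ι s)) * ∏ j, expMode (((σ j : ℕ) : ℝ) - ((τ j : ℕ) : ℝ)) (θ j))
          ∂(Measure.pi fun _ => angleVol)
      = ∑ σ : Equiv.Perm (Fin N), (2 * (Real.pi : ℂ)) ^ N *
          ∫ x, f x * (modeMatrix (fun s => σ (ι s)) x).det
            ∂(Measure.pi fun _ => angleVol) := fun ι => by
    rw [integral_finsetSum _ fun σ _ => integrable_finsetSum _ fun τ _ => hint ι σ τ,
      Finset.mul_sum]
    exact Finset.sum_congr rfl fun σ _ => hterm ι σ
  rw [Finset.mul_sum]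
  simp only [hinner]
  rw [Finset.sum_comm]
  -- Composing with σ permutes the embeddings, so each σ contributes the same amount; this is the
  -- source of N!.
  have hshift : ∀ σ : Equiv.Perm (Fin N),
      (∑ ι : Fin r ↪ Fin N, (2 * (Real.pi : ℂ)) ^ N *
        ∫ x, f x * (modeMatrix (fun s => σ (ι s)) x).det ∂(Measure.pi fun _ => angleVol))
      = (2 * (Real.pi : ℂ)) ^ N * ∑ m : Fin r → Fin N,
          ∫ x, f x * (modeMatrix m x).det ∂(Measure.pi fun _ => angleVol) := fun σ => by
    rw [← Finset.mul_sum, ← sum_embedding_eq_sum (fun m : Fin r → Fin N =>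
      ∫ x, f x * (modeMatrix m x).det ∂(Measure.pi fun _ => angleVol))
      fun m hm => by simp [det_modeMatrix_of_not_injective hm]]
    congr 1
    exact Fintype.sum_equiv (Equiv.embeddingCongr (Equiv.refl _) σ) _ _ fun ι => rfl
  simp only [hshift]
  rw [Finset.sum_const, Finset.card_univ, Fintype.card_perm, Fintype.card_fin, nsmul_eq_mul]
  ring

/-- The case r = 0: there is one empty embedding and the empty determinant is 1. -/
lemma cueZ_eq (N : ℕ) : (cueZ N : ℂ) = (N.factorial : ℂ) * (2 * (Real.pi : ℂ)) ^ N := by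
  have h := integral_weight_sum_embedding (r := 0) N (f := fun _ => 1) measurable_const (C := 1)
    (by simp)
  rw [cueZ_eq_integral]
  simpa [measureReal_def] using h

/-- The `r`-point averages of the ensemble over distinct indices. -/
lemma integral_cueLaw_sum_embedding {r : ℕ} (N : ℕ) {f : (Fin r → ℝ) → ℂ} (hf : Measurable f)
    {C : ℝ} (hC : ∀ x, ‖f x‖ ≤ C) :
    ∫ θ, ∑ ι : Fin r ↪ Fin N, f (fun s => θ (ι s)) ∂(cueLaw N)
      = (1 / (2 * (Real.pi : ℂ))) ^ r * ∑ m : Fin r → Fin N,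
          ∫ x, f x * (modeMatrix m x).det ∂(Measure.pi fun _ => angleVol) := by
  have h := integral_weight_sum_embedding N hf hC
  have h2 := two_pi_ne_zero'
  have h3 : (N.factorial : ℂ) ≠ 0 := by exact_mod_cast N.factorial_ne_zero
  rw [integral_cueLaw, cueZ_eq, one_div, inv_pow, inv_mul_eq_iff_eq_mul₀ (by positivity)]
  refine mul_left_cancel₀ (pow_ne_zero r h2) ?_
  rw [h]
  field_simp

instance isFiniteMeasure_cueLaw (N : ℕ) : IsFiniteMeasure (cueLaw N) := by
  have hmeas : (volume : Measure (Fin N → ℝ)).restrict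
      (Set.univ.pi (fun _ : Fin N => angleInterval)) = Measure.pi fun _ => angleVol :=
    Measure.restrict_pi_pi _ _
  unfold cueLaw
  rw [hmeas]
  refine isFiniteMeasure_withDensity_ofReal (Integrable.hasFiniteIntegral ?_)
  have hcont : Continuous (cueWeight N) := by unfold cueWeight; fun_prop
  unfold cuePDF
  refine Integrable.div_const (Integrable.of_bound hcont.aestronglyMeasurable
    (∏ j : Fin N, ∏ l ∈ Finset.Ioi j, (2 : ℝ) ^ 2) (Eventually.of_forall fun θ => ?_)) _
  unfold cueWeight
  rw [norm_prod]
  refine Finset.prod_le_prod (fun _ _ => norm_nonneg _) fun j _ => ?_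
  rw [norm_prod]
  refine Finset.prod_le_prod (fun _ _ => norm_nonneg _) fun l _ => ?_
  rw [norm_pow, norm_norm]
  refine pow_le_pow_left₀ (norm_nonneg _) ((norm_sub_le _ _).trans ?_) 2
  simp only [mul_comm Complex.I, Complex.norm_exp_ofReal_mul_I]
  norm_num

/-! ### Integrals of modes against determinants. -/

lemma integral_pi_fin_succ {n : ℕ} {F : (Fin (n + 1) → ℝ) → ℂ}
    (hF : Integrable F (Measure.pi fun _ => angleVol)) :
    ∫ x, F x ∂(Measure.pi fun _ => angleVol)
      = ∫ y : Fin n → ℝ, ∫ u, F (Fin.cons u y) ∂angleVol ∂(Measure.pi fun _ => angleVol) := by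
  have h := (measurePreserving_piFinSuccAbove (fun _ : Fin (n + 1) => angleVol) 0).symm
  rw [← h.integral_comp']
  refine (integral_prod_symm
    (fun z => F ((MeasurableEquiv.piFinSuccAbove (fun _ : Fin (n + 1) => ℝ) 0).symm z))
    (h.integrable_comp_of_integrable hF)).trans ?_
  simp [MeasurableEquiv.piFinSuccAbove, Fin.insertNthEquiv]

lemma measurable_fin_apply_sub {n : ℕ} (i j : Fin n) :
    Measurable fun x : Fin n → ℝ => angleMod (x i - x j) :=
  measurable_angleMod.comp ((measurable_pi_apply i).sub (measurable_pi_apply j))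

/-- Substituting u = x₀ - x_l modulo 2π moves the integer frequency a₀ onto x_l and leaves E(κ + a₀)
from u; the other variables obey orthogonality. -/
lemma integral_expMode_angleMod_mul_prod {n : ℕ} (l : Fin n) (κ : ℝ) (a : Fin (n + 1) → ℤ) :
    (1 / (2 * (Real.pi : ℂ))) ^ (n + 1) *
      ∫ x, expMode κ (angleMod (x 0 - x l.succ)) * ∏ s, expMode (a s) (x s)
        ∂(Measure.pi fun _ => angleVol)
      = modeMean (κ + a 0) *
          ∏ s : Fin n, if a s.succ + (if s = l then a 0 else 0) = 0 then 1 else 0 := by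
  rw [integral_pi_fin_succ (integrable_mul_prod_expMode
    (f := fun x => expMode κ (angleMod (x 0 - x l.succ))) ((measurable_expMode κ).comp (measurable_fin_apply_sub 0 l.succ)) (C := 1)
    (fun x => (norm_expMode _ _).le) _)]
  have h1 : ∀ y : Fin n → ℝ, (∫ u, expMode κ (angleMod ((Fin.cons u y : Fin (n + 1) → ℝ) 0
        - (Fin.cons u y : Fin (n + 1) → ℝ) l.succ)) *
        ∏ s, expMode (a s) ((Fin.cons u y : Fin (n + 1) → ℝ) s) ∂angleVol)
      = (2 * (Real.pi : ℂ) * modeMean (κ + a 0)) *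
        ∏ s : Fin n, expMode ((a s.succ + (if s = l then a 0 else 0) : ℤ) : ℝ) (y s) := by
    intro y
    have h2 : ∀ u, expMode κ (angleMod ((Fin.cons u y : Fin (n + 1) → ℝ) 0
        - (Fin.cons u y : Fin (n + 1) → ℝ) l.succ)) *
        ∏ s, expMode (a s) ((Fin.cons u y : Fin (n + 1) → ℝ) s)
        = expMode (κ + a 0) (angleMod (u - y l)) *
          ∏ s : Fin n, expMode ((a s.succ + (if s = l then a 0 else 0) : ℤ) : ℝ) (y s) := by
      intro u
      have h3 : ∏ s : Fin n, expMode ((if s = l then a 0 else 0 : ℤ) : ℝ) (y s)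
          = expMode (a 0) (y l) := by
        rw [Finset.prod_eq_single l]
        · simp
        · intro s _ hs
          simp [hs]
        · simp
      have h4 : expMode (a 0) u = expMode (a 0) (y l) * expMode (a 0) (angleMod (u - y l)) := by
        rw [expMode_int_angleMod, ← expMode_add_right]
        congr 1
        ring
      rw [Fin.prod_univ_succ]
      simp only [Fin.cons_zero, Fin.cons_succ]
      simp only [Int.cast_add, expMode_add_left, Finset.prod_mul_distrib]
      rw [h3, h4]
      ring
    simp only [h2]
    rw [integral_mul_const, integral_angleMod_sub, integral_expMode]
  simp only [h1]
  rw [integral_const_mul, integral_fintype_prod_eq_prod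
    (f := fun (s : Fin n) => expMode ((a s.succ + (if s = l then a 0 else 0) : ℤ) : ℝ))]
  simp only [integral_expMode, modeMean_int, Finset.prod_mul_distrib, Finset.prod_const,
    Finset.card_univ, Fintype.card_fin]
  have := two_pi_ne_zero'
  have hpi : (Real.pi : ℂ) ≠ 0 := by simp [Real.pi_ne_zero]
  rw [one_div, inv_pow, pow_succ, mul_pow]
  field_simp

/-- Each Leibniz term has frequencies m_s - m_{ρ(s)}, which sum to zero, so `h` is needed only for
such `a`. The product form then reassembles the terms into a scalar determinant. -/
lemma integral_mul_det_modeMatrix {r N : ℕ} {f : (Fin r → ℝ) → ℂ} (hf : Measurable f)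
    {C : ℝ} (hC : ∀ x, ‖f x‖ ≤ C) (c : ℂ) (g : Fin r → ℤ → ℂ)
    (h : ∀ a : Fin r → ℤ, ∑ s, a s = 0 →
      c * ∫ x, f x * ∏ s, expMode (a s) (x s) ∂(Measure.pi fun _ => angleVol) = ∏ s, g s (a s))
    (m : Fin r → Fin N) :
    c * ∫ x, f x * (modeMatrix m x).det ∂(Measure.pi fun _ => angleVol)
      = (Matrix.of fun t s : Fin r => g s ((m s : ℕ) - (m t : ℕ) : ℤ)).det := by
  have e : ∀ x, f x * (modeMatrix m x).det = ∑ ρ : Equiv.Perm (Fin r), permSign ρ *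
      (f x * ∏ s, expMode ((((m s : ℕ) - (m (ρ s) : ℕ) : ℤ)) : ℝ) (x s)) := fun x => by
    rw [det_modeMatrix, Finset.mul_sum]
    refine Finset.sum_congr rfl fun ρ _ => ?_
    simp only [permSign]
    push_cast
    ring
  simp only [e]
  rw [integral_finsetSum _ fun ρ _ => (integrable_mul_prod_expMode hf hC _).const_mul _,
    Finset.mul_sum, Matrix.det_apply']
  refine Finset.sum_congr rfl fun ρ _ => ?_
  rw [integral_const_mul, mul_left_comm, h]
  · rfl
  · rw [Finset.sum_sub_distrib, Equiv.sum_comp ρ (fun s => ((m s : ℕ) : ℤ)), sub_self]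

/-! ### Index sums split by coincidences. -/

lemma sum_fun_fin_succ {A : Type*} [Fintype A] {n : ℕ} (F : (Fin (n + 1) → A) → ℂ) :
    ∑ m, F m = ∑ i, ∑ m : Fin n → A, F (Fin.cons i m) := by
  rw [← Fintype.sum_prod_type']
  exact (Fintype.sum_equiv (Fin.consEquiv fun _ => A) _ _ fun p => rfl).symm

lemma sum_fun_fin_one {A : Type*} [Fintype A] (F : (Fin 1 → A) → ℂ) :
    ∑ m, F m = ∑ i, F ![i] := by
  rw [sum_fun_fin_succ]
  refine Finset.sum_congr rfl fun i _ => ?_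
  rw [Fintype.sum_unique]
  congr 1

lemma sum_fun_fin_two {A : Type*} [Fintype A] (F : (Fin 2 → A) → ℂ) :
    ∑ m, F m = ∑ i, ∑ j, F ![i, j] := by
  rw [sum_fun_fin_succ]
  refine Finset.sum_congr rfl fun i _ => ?_
  rw [sum_fun_fin_one]
  rfl

lemma sum_fun_fin_three {A : Type*} [Fintype A] (F : (Fin 3 → A) → ℂ) :
    ∑ m, F m = ∑ i, ∑ j, ∑ l, F ![i, j, l] := by
  rw [sum_fun_fin_succ]
  refine Finset.sum_congr rfl fun i _ => ?_
  rw [sum_fun_fin_two]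
  rfl

lemma sum_embedding_one {N : ℕ} (g : Fin N → ℂ) : ∑ ι : Fin 1 ↪ Fin N, g (ι 0) = ∑ i, g i := by
  rw [sum_embedding_eq_sum (fun m : Fin 1 → Fin N => g (m 0))
    (fun m hm => absurd (Function.injective_of_subsingleton m) hm), sum_fun_fin_one]
  rfl

lemma sum_embedding_two {N : ℕ} (g : Fin N → Fin N → ℂ) :
    ∑ ι : Fin 2 ↪ Fin N, g (ι 0) (ι 1) = ∑ i, ∑ j, if i ≠ j then g i j else 0 := by
  have h := sum_embedding_eq_sum
    (fun m : Fin 2 → Fin N => if m 0 ≠ m 1 then g (m 0) (m 1) else 0) (fun m hm => by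
      refine if_neg fun hne => hm ?_
      intro s t hst
      fin_cases s <;> fin_cases t <;> simp_all)
  rw [sum_fun_fin_two] at h
  refine Eq.trans (Finset.sum_congr rfl fun ι _ => ?_) h
  rw [if_pos (ι.injective.ne (by decide))]

lemma sum_embedding_three {N : ℕ} (g : Fin N → Fin N → Fin N → ℂ) :
    ∑ ι : Fin 3 ↪ Fin N, g (ι 0) (ι 1) (ι 2)
      = ∑ i, ∑ j, ∑ l, if i ≠ j ∧ i ≠ l ∧ j ≠ l then g i j l else 0 := by
  have h := sum_embedding_eq_sum
    (fun m : Fin 3 → Fin N => if m 0 ≠ m 1 ∧ m 0 ≠ m 2 ∧ m 1 ≠ m 2 then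
      g (m 0) (m 1) (m 2) else 0) (fun m hm => by
      refine if_neg fun hne => hm ?_
      obtain ⟨h1, h2, h3⟩ := hne
      intro s t hst
      fin_cases s <;> fin_cases t <;> simp_all)
  rw [sum_fun_fin_three] at h
  refine Eq.trans (Finset.sum_congr rfl fun ι _ => ?_) h
  rw [if_pos ⟨ι.injective.ne (by decide), ι.injective.ne (by decide), ι.injective.ne (by decide)⟩]

lemma sum_sum_eq_embedding {N : ℕ} (g : Fin N → Fin N → ℂ) :
    ∑ i, ∑ j, g i j = ∑ ι : Fin 2 ↪ Fin N, g (ι 0) (ι 1) + ∑ i, g i i := by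
  rw [sum_embedding_two, ← Finset.sum_add_distrib]
  refine Finset.sum_congr rfl fun i _ => ?_
  have : g i i = ∑ j, if i = j then g i j else 0 := by simp
  rw [this, ← Finset.sum_add_distrib]
  refine Finset.sum_congr rfl fun j _ => ?_
  by_cases h : i = j <;> simp [h]

/-- The five terms are the set partitions of three indices. The labels in the case i = l are swapped
so that each pair term later becomes a mode of θ(ι 0) - θ(ι 1). -/
lemma sum_sum_sum_eq_embedding {N : ℕ} (g : Fin N → Fin N → Fin N → ℂ) :
    ∑ i, ∑ j, ∑ l, g i j l = ∑ ι : Fin 3 ↪ Fin N, g (ι 0) (ι 1) (ι 2)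
      + ∑ ι : Fin 2 ↪ Fin N, g (ι 0) (ι 0) (ι 1)
      + ∑ ι : Fin 2 ↪ Fin N, g (ι 1) (ι 0) (ι 1)
      + ∑ ι : Fin 2 ↪ Fin N, g (ι 0) (ι 1) (ι 1) + ∑ i, g i i i := by
  have hpt : ∀ i j l, g i j l = (if i ≠ j ∧ i ≠ l ∧ j ≠ l then g i j l else 0)
      + (if i = j then (if i ≠ l then g i i l else 0) else 0)
      + (if i = l then (if j ≠ i then g i j i else 0) else 0)
      + (if j = l then (if i ≠ j then g i j j else 0) else 0)
      + (if i = j then (if i = l then g i i i else 0) else 0) := by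
    intro i j l
    by_cases h1 : i = j
    · subst h1
      by_cases h2 : i = l
      · subst h2
        simp
      · simp [h2]
    · by_cases h2 : i = l
      · subst h2
        simp [h1, Ne.symm h1]
      · by_cases h3 : j = l
        · subst h3
          simp [h1]
        · simp [h1, h2, h3]
  rw [sum_embedding_three, sum_embedding_two (fun i l => g i i l),
    sum_embedding_two (fun j i => g i j i), sum_embedding_two (fun i j => g i j j)]
  rw [Finset.sum_congr rfl fun i _ => Finset.sum_congr rfl fun j _ =>
    Finset.sum_congr rfl fun l _ => hpt i j l]
  simp only [Finset.sum_add_distrib]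
  congr 1
  · congr 1
    · congr 1
      · congr 1
        refine Finset.sum_congr rfl fun i _ => ?_
        rw [Finset.sum_comm]
        simp
      · rw [Finset.sum_comm]
        simp
    · simp
  · refine Finset.sum_congr rfl fun i _ => ?_
    rw [Finset.sum_comm]
    simp

/-! ### Moments and the third cumulant as finite sums. -/

/-- `⟨n(x)⟩ = N / 2π`. -/
lemma cueMoment1_eq (N : ℕ) {f : ℝ → ℂ} (hf : Measurable f) {C : ℝ} (hC : ∀ x, ‖f x‖ ≤ C) :
    cueMoment1 N f = N * (1 / (2 * (Real.pi : ℂ)) * ∫ u, f u ∂angleVol) := by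
  have h := integral_cueLaw_sum_embedding N (r := 1) (f := fun x => f (x 0))
    (hf.comp (measurable_pi_apply 0)) (fun x => hC _)
  have h1 : ∫ x : Fin 1 → ℝ, f (x 0) ∂(Measure.pi fun _ => angleVol) = ∫ u, f u ∂angleVol := by
    have := integral_fintype_prod_eq_prod (𝕜 := ℂ) (ι := Fin 1) (E := fun _ => ℝ)
      (fun _ => f) (μ := fun _ => angleVol)
    simpa using this
  have h2 : ∀ θ : Fin N → ℝ, ∑ ι : Fin 1 ↪ Fin N, f (θ (ι 0)) = ∑ i, f (θ i) := fun θ =>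
    sum_embedding_one fun i => f (θ i)
  simp only [h2] at h
  unfold cueMoment1
  rw [h]
  simp [modeMatrix, h1]
  ring

/-- The sum `∑ E(κ + m - n)` over `0 ≤ m, n < N` of the means of exponentials. -/
def pairSum (N : ℕ) (κ : ℝ) : ℂ :=
  ∑ m : Fin N, ∑ n : Fin N, modeMean (κ + ((m : ℕ) - (n : ℕ) : ℤ))

/-- Averages of `e^{iκ(x - y)}` over pairs of distinct eigenangles. -/
lemma integral_sum_embedding_two (N : ℕ) (κ : ℝ) :
    ∫ θ, ∑ ι : Fin 2 ↪ Fin N, expMode κ (angleMod (θ (ι 0) - θ (ι 1))) ∂(cueLaw N)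
      = (N : ℂ) ^ 2 * modeMean κ - pairSum N κ := by
  have hf : Measurable fun x : Fin 2 → ℝ => expMode κ (angleMod (x 0 - x 1)) :=
    (measurable_expMode κ).comp (measurable_fin_apply_sub 0 1)
  have hC : ∀ x : Fin 2 → ℝ, ‖expMode κ (angleMod (x 0 - x 1))‖ ≤ 1 := fun x =>
    (norm_expMode _ _).le
  rw [integral_cueLaw_sum_embedding N hf hC, Finset.mul_sum]
  rw [Finset.sum_congr rfl fun m _ => integral_mul_det_modeMatrix hf hC _
    ![fun p => modeMean (κ + p), fun _ => 1] (fun a ha => by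
      have h := integral_expMode_angleMod_mul_prod (0 : Fin 1) κ a
      rw [Fin.sum_univ_two] at ha
      simp only [Fin.prod_univ_one, Fin.succ_zero_eq_one, if_true] at h
      rw [if_pos (by linarith)] at h
      rw [Fin.prod_univ_two (fun s => ![fun p : ℤ => modeMean (κ + p), fun _ => 1] s (a s))]
      exact h) m]
  rw [sum_fun_fin_two]
  simp only [Matrix.det_fin_two, Matrix.of_apply, Matrix.cons_val_zero, Matrix.cons_val_one,
    sub_self, Int.cast_zero, add_zero, mul_one, one_mul, Finset.sum_sub_distrib]
  simp [pairSum]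
  ring

lemma integrable_sum_cueLaw {N : ℕ} {J : Type*} [Fintype J] {g : J → (Fin N → ℝ) → ℂ}
    (hg : ∀ j, Measurable (g j)) (hC : ∀ j θ, ‖g j θ‖ ≤ 1) :
    Integrable (fun θ => ∑ j, g j θ) (cueLaw N) :=
  integrable_finsetSum _ fun j _ => integrable_of_measurable_of_bound (hg j) (hC j)

lemma measurable_expMode_angleMod_sub {N : ℕ} (κ : ℝ) (i j : Fin N) :
    Measurable fun θ : Fin N → ℝ => expMode κ (angleMod (θ i - θ j)) :=
  (measurable_expMode κ).comp (measurable_fin_apply_sub i j)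

lemma integral_cueLaw_one (N : ℕ) : ∫ _θ, (1 : ℂ) ∂(cueLaw N) = 1 := by
  have h := integral_cueLaw_sum_embedding N (r := 0) (f := fun _ => 1) measurable_const (C := 1)
    (by simp)
  simpa [measureReal_def] using h

lemma cueMoment2_expMode (N : ℕ) (κ : ℝ) :
    cueMoment2 N (fun x y => expMode κ (angleMod (x - y)))
      = (N : ℂ) ^ 2 * modeMean κ - pairSum N κ + N := by
  unfold cueMoment2
  simp only [sum_sum_eq_embedding (N := N)]
  rw [integral_add (integrable_sum_cueLaw (fun _ => measurable_expMode_angleMod_sub _ _ _)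
    fun _ _ => (norm_expMode _ _).le) (integrable_sum_cueLaw
    (fun _ => measurable_expMode_angleMod_sub _ _ _) fun _ _ => (norm_expMode _ _).le),
    integral_sum_embedding_two]
  congr 1
  simp only [sub_self, angleMod_zero, expMode_zero_right]
  rw [integral_finsetSum _ fun _ _ => integrable_const _]
  simp only [integral_cueLaw_one]
  simp

/-- The contribution of the two `3`-cycles to the third cumulant. -/
def cycleSum (N : ℕ) (k : ℝ) (b : ℕ) : ℂ :=
  ∑ m : Fin N, ∑ n : Fin N, ∑ p : Fin N,
    (modeMean (b + ((n : ℕ) - (m : ℕ) : ℤ)) * modeMean (k + ((m : ℕ) - (p : ℕ) : ℤ))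
      + modeMean (k + ((m : ℕ) - (n : ℕ) : ℤ)) * modeMean (b + ((n : ℕ) - (p : ℕ) : ℤ)))

lemma modeMean_nat_add_int (b : ℕ) (p : ℤ) :
    modeMean (b + p) = if (b : ℤ) + p = 0 then 1 else 0 := by
  have := modeMean_int ((b : ℤ) + p)
  push_cast at this
  exact this

lemma modeMean_nat_mul (b : ℕ) (F : ℤ → ℂ) (p : ℤ) :
    modeMean (b + p) * F p = modeMean (b + p) * F (-b) := by
  rw [modeMean_nat_add_int]
  split_ifs with h
  · rw [show p = -(b : ℤ) by linarith]
  · simp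

/-- Averages of `e^{ik(x - z)} e^{ib(y - z)}` over triples of distinct eigenangles. -/
lemma integral_sum_embedding_three (N : ℕ) (k : ℝ) (b : ℕ) :
    ∫ θ, ∑ ι : Fin 3 ↪ Fin N, expMode k (angleMod (θ (ι 0) - θ (ι 2))) *
        expMode b (angleMod (θ (ι 1) - θ (ι 2))) ∂(cueLaw N)
      = (N : ℂ) ^ 3 * modeMean k * modeMean b - N * modeMean k * pairSum N b
        - N * modeMean (k + b) * pairSum N b - N * modeMean b * pairSum N k
        + cycleSum N k b := by
  have hf : Measurable fun x : Fin 3 → ℝ => expMode k (angleMod (x 0 - x 2)) *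
      expMode b (angleMod (x 1 - x 2)) :=
    (measurable_expMode_angleMod_sub _ _ _).mul (measurable_expMode_angleMod_sub _ _ _)
  have hC : ∀ x : Fin 3 → ℝ, ‖expMode k (angleMod (x 0 - x 2)) *
      expMode b (angleMod (x 1 - x 2))‖ ≤ 1 := fun x => by
    rw [norm_mul, norm_expMode, norm_expMode, one_mul]
  rw [integral_cueLaw_sum_embedding N hf hC, Finset.mul_sum]
  rw [Finset.sum_congr rfl fun m _ => integral_mul_det_modeMatrix hf hC _
    ![fun p => modeMean (k + p), fun p => modeMean (b + p), fun _ => 1] (fun a ha => by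
      -- As b is an integer, e^{ib(y-z)} is absorbed into the integer frequencies: b is added at y
      -- and subtracted at z.
      have h := integral_expMode_angleMod_mul_prod (1 : Fin 2) k ![a 0, a 1 + b, a 2 - b]
      have e : ∀ x : Fin 3 → ℝ, expMode k (angleMod (x 0 - x 2)) *
          expMode b (angleMod (x 1 - x 2)) * ∏ s, expMode (a s) (x s)
          = expMode k (angleMod (x 0 - x (1 : Fin 2).succ)) *
            ∏ s, expMode ((![a 0, a 1 + b, a 2 - b] s : ℤ) : ℝ) (x s) := fun x => by
        have h1 := expMode_int_angleMod b (x 1 - x 2)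
        rw [Int.cast_natCast] at h1
        rw [h1, Fin.prod_univ_three, Fin.prod_univ_three]
        simp only [Fin.succ_one_eq_two, Matrix.cons_val_zero, Matrix.cons_val_one,
          Matrix.cons_val, Int.cast_add, Int.cast_neg, Int.cast_natCast, sub_eq_add_neg,
          expMode_add_left, expMode_add_right, expMode_neg_right]
        ring
      simp only [e]
      refine h.trans ?_
      rw [Fin.sum_univ_three] at ha
      rw [Fin.prod_univ_three (fun s => ![fun p : ℤ => modeMean (k + p),
        fun p : ℤ => modeMean (b + p), fun _ => 1] s (a s))]
      simp only [Fin.prod_univ_two, Fin.succ_zero_eq_one, Fin.succ_one_eq_two,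
        Matrix.cons_val_zero, Matrix.cons_val_one, Matrix.cons_val, modeMean_nat_add_int,
        zero_ne_one, if_false, if_true, add_zero, mul_one]
      by_cases hb : a 1 + b = 0
      · rw [if_pos hb, if_pos (by linarith), if_pos (by linarith)]
        ring
      · have hb' : ¬ (b : ℤ) + a 1 = 0 := fun h0 => hb (by linarith)
        simp [hb, hb']) m]
  rw [sum_fun_fin_three]
  have hpt : ∀ m n p : Fin N, (Matrix.of fun t s : Fin 3 =>
      (![fun p : ℤ => modeMean (k + p), fun p : ℤ => modeMean (b + p), fun _ => 1] :
        Fin 3 → ℤ → ℂ) s (((![m, n, p] s : Fin N) : ℕ) - ((![m, n, p] t : Fin N) : ℕ) : ℤ)).det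
      = modeMean k * modeMean b
        - modeMean k * modeMean (b + ((n : ℕ) - (p : ℕ) : ℤ))
        - modeMean (k + b) * modeMean (b + ((n : ℕ) - (m : ℕ) : ℤ))
        - modeMean b * modeMean (k + ((m : ℕ) - (p : ℕ) : ℤ))
        + (modeMean (b + ((n : ℕ) - (m : ℕ) : ℤ)) * modeMean (k + ((m : ℕ) - (p : ℕ) : ℤ))
      + modeMean (k + ((m : ℕ) - (n : ℕ) : ℤ)) * modeMean (b + ((n : ℕ) - (p : ℕ) : ℤ))) := by
    intro m n p
    -- The transposition of x and y yields the right-hand product; its delta factor forces n - m =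
    -- -b and so freezes the other factor at E(k + b).
    have h1 : modeMean (k + b) * modeMean (b + ((n : ℕ) - (m : ℕ) : ℤ))
        = modeMean (k + ((m : ℕ) - (n : ℕ) : ℤ)) * modeMean (b + ((n : ℕ) - (m : ℕ) : ℤ)) := by
      have := modeMean_nat_mul b (fun q => modeMean (k + (-q : ℤ))) ((n : ℕ) - (m : ℕ))
      simp only [neg_sub, neg_neg, Int.cast_natCast] at this
      rw [mul_comm, ← this, mul_comm]
    rw [h1, Matrix.det_fin_three]
    simp only [Matrix.of_apply, Matrix.cons_val_zero, Matrix.cons_val_one, Matrix.cons_val,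
      sub_self, Int.cast_zero, add_zero]
    ring
  simp only [hpt]
  have hs : ∑ n : Fin N, ∑ p : Fin N, modeMean (b + ((p : ℕ) - (n : ℕ) : ℤ)) = pairSum N b := by
    rw [pairSum, Finset.sum_comm]
  simp only [Finset.sum_add_distrib, Finset.sum_sub_distrib, ← Finset.mul_sum, Finset.sum_const,
    Finset.card_univ, Fintype.card_fin, nsmul_eq_mul, hs, cycleSum]
  simp only [pairSum]
  ring

lemma integral_add_five {α : Type*} [MeasurableSpace α] {μ : Measure α}
    {f₁ f₂ f₃ f₄ f₅ : α → ℂ} (h₁ : Integrable f₁ μ) (h₂ : Integrable f₂ μ)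
    (h₃ : Integrable f₃ μ) (h₄ : Integrable f₄ μ) (h₅ : Integrable f₅ μ) :
    ∫ x, (f₁ x + f₂ x + f₃ x + f₄ x + f₅ x) ∂μ
      = ∫ x, f₁ x ∂μ + ∫ x, f₂ x ∂μ + ∫ x, f₃ x ∂μ + ∫ x, f₄ x ∂μ + ∫ x, f₅ x ∂μ := by
  have h₁₂ : Integrable (fun x => f₁ x + f₂ x) μ := h₁.add h₂
  have h₁₃ : Integrable (fun x => f₁ x + f₂ x + f₃ x) μ := h₁₂.add h₃
  have h₁₄ : Integrable (fun x => f₁ x + f₂ x + f₃ x + f₄ x) μ := h₁₃.add h₄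
  rw [integral_add h₁₄ h₅, integral_add h₁₃ h₄, integral_add h₁₂ h₃, integral_add h₁ h₂]

lemma cueMoment3_expMode (N : ℕ) (k : ℝ) (b : ℕ) :
    cueMoment3 N (fun x y z => expMode k (angleMod (x - z)) * expMode b (angleMod (y - z)))
      = ((N : ℂ) ^ 3 * modeMean k * modeMean b - N * modeMean k * pairSum N b
        - N * modeMean (k + b) * pairSum N b - N * modeMean b * pairSum N k
        + cycleSum N k b)
        + ((N : ℂ) ^ 2 * modeMean (k + b) - pairSum N (k + b))
        + ((N : ℂ) ^ 2 * modeMean b - pairSum N b)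
        + ((N : ℂ) ^ 2 * modeMean k - pairSum N k) + N := by
  unfold cueMoment3
  simp only [sum_sum_sum_eq_embedding (N := N), sub_self, angleMod_zero, expMode_zero_right,
    one_mul, mul_one, ← expMode_add_left]
  have h2 : ∀ κ : ℝ, Integrable (fun θ : Fin N → ℝ =>
      ∑ ι : Fin 2 ↪ Fin N, expMode κ (angleMod (θ (ι 0) - θ (ι 1)))) (cueLaw N) := fun κ =>
    integrable_sum_cueLaw (fun _ => measurable_expMode_angleMod_sub _ _ _)
      fun _ _ => (norm_expMode _ _).le
  have h3 : Integrable (fun θ : Fin N → ℝ =>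
      ∑ ι : Fin 3 ↪ Fin N, expMode k (angleMod (θ (ι 0) - θ (ι 2))) *
        expMode b (angleMod (θ (ι 1) - θ (ι 2)))) (cueLaw N) :=
    integrable_sum_cueLaw (fun _ => (measurable_expMode_angleMod_sub _ _ _).mul
      (measurable_expMode_angleMod_sub _ _ _)) fun _ _ => by
        rw [norm_mul, norm_expMode, norm_expMode, one_mul]
  rw [integral_add_five h3 (h2 _) (h2 _) (h2 _) (integrable_const _), integral_sum_embedding_three, integral_sum_embedding_two,
    integral_sum_embedding_two, integral_sum_embedding_two]
  congr 1
  rw [integral_finsetSum _ fun _ _ => integrable_const _]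
  simp only [integral_cueLaw_one]
  simp

lemma cueMoment1_mul_expMode (N : ℕ) (c : ℂ) (κ z : ℝ) :
    cueMoment1 N (fun x => c * expMode κ (angleMod (x - z))) = c * (N * modeMean κ) := by
  rw [cueMoment1_eq N (C := ‖c‖) (by fun_prop) (fun x => by rw [norm_mul, norm_expMode, mul_one]),
    integral_const_mul, integral_angleMod_sub, integral_expMode]
  have := two_pi_ne_zero'
  have hpi : (Real.pi : ℂ) ≠ 0 := by simp [Real.pi_ne_zero]
  field_simp

lemma cueMoment1_mul_expMode_left (N : ℕ) (c : ℂ) (κ x : ℝ) :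
    cueMoment1 N (fun z => c * expMode κ (angleMod (x - z))) = c * (N * modeMean κ) := by
  rw [cueMoment1_eq N (C := ‖c‖) (by fun_prop) (fun x => by rw [norm_mul, norm_expMode, mul_one]),
    integral_const_mul, integral_angleMod_sub_left, integral_expMode]
  have := two_pi_ne_zero'
  have hpi : (Real.pi : ℂ) ≠ 0 := by simp [Real.pi_ne_zero]
  field_simp

lemma cueMoment1_const (N : ℕ) (c : ℂ) : cueMoment1 N (fun _ => c) = N * c := by
  simpa [modeMean_zero, mul_comm] using cueMoment1_mul_expMode N c 0 0

lemma cueMoment2_const_mul (N : ℕ) (c : ℂ) (f : ℝ → ℝ → ℂ) :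
    cueMoment2 N (fun x y => c * f x y) = c * cueMoment2 N f := by
  unfold cueMoment2
  simp only [← Finset.mul_sum, integral_const_mul]

/-- Needed because averaging over z leaves the mode of frequency -b in x - y. Swapping the two
indices suffices, as E is even on integers. -/
lemma pairSum_neg (N : ℕ) (b : ℕ) : pairSum N (-b) = pairSum N b := by
  unfold pairSum
  rw [Finset.sum_comm]
  refine Finset.sum_congr rfl fun m _ => Finset.sum_congr rfl fun n _ => ?_
  have h1 := modeMean_int (-(b : ℤ) + ((n : ℕ) - (m : ℕ) : ℤ))
  have h2 := modeMean_int ((b : ℤ) + ((m : ℕ) - (n : ℕ) : ℤ))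
  push_cast at h1 h2 ⊢
  rw [h1, h2]
  have : (-(b : ℤ) + ((n : ℕ) - (m : ℕ) : ℤ)) = 0 ↔ ((b : ℤ) + ((m : ℕ) - (n : ℕ) : ℤ)) = 0 := by
    constructor <;> intro <;> linarith
  simp only [this]

lemma modeMean_nat (b : ℕ) : modeMean b = if b = 0 then 1 else 0 := by
  have := modeMean_int b
  simpa using this

lemma cueCumulant3_expMode (N : ℕ) (k : ℝ) (b : ℕ) :
    cueCumulant3 N (fun x y z => expMode k (angleMod (x - z)) * expMode b (angleMod (y - z)))
      = cycleSum N k b - pairSum N (k + b) - pairSum N b - pairSum N k + N := by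
  have hb : ∀ u, expMode b (angleMod u) = expMode b u := fun u => by
    simpa using expMode_int_angleMod b u
  have hb' : ∀ u, expMode (-b) (angleMod u) = expMode (-b) u := fun u => by
    simpa using expMode_int_angleMod (-b) u
  have hz : ∀ x y, cueMoment1 N (fun z => expMode k (angleMod (x - z)) *
      expMode b (angleMod (y - z))) = (N * modeMean (k + b)) * expMode (-b) (angleMod (x - y)) := by
    intro x y
    rw [mul_comm, ← cueMoment1_mul_expMode_left N _ _ x]
    congr 1
    funext z
    rw [expMode_add_left, hb, hb, hb', ← expMode_neg_right, mul_left_comm, ← expMode_add_right]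
    congr 2
    ring
  have hy : ∀ x z, cueMoment1 N (fun y => expMode k (angleMod (x - z)) *
      expMode b (angleMod (y - z))) = (N * modeMean b) * expMode k (angleMod (x - z)) := by
    intro x z
    rw [cueMoment1_mul_expMode, mul_comm]
  have hx : ∀ y z, cueMoment1 N (fun x => expMode k (angleMod (x - z)) *
      expMode b (angleMod (y - z))) = (N * modeMean k) * expMode b (angleMod (y - z)) := by
    intro y z
    rw [mul_comm, ← cueMoment1_mul_expMode N _ _ z]
    simp only [mul_comm]
  have hneg : modeMean (-b) = modeMean b := by
    have h1 := modeMean_int (-(b : ℤ))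
    push_cast at h1
    rw [h1, modeMean_nat]
    simp
  -- Both sides vanish unless b = 0. This cancels the N³ terms, the only ones that do not cancel
  -- identically.
  have hδ : modeMean b * modeMean (k + b) = modeMean b * modeMean k := by
    rw [modeMean_nat]
    split_ifs with h <;> simp [h]
  have h111 : cueMoment1 N (fun x => cueMoment1 N (fun y =>
      (N * modeMean (k + b)) * expMode (-b) (angleMod (x - y))))
      = N * ((N * modeMean (k + b)) * (N * modeMean b)) := by
    simp only [cueMoment1_mul_expMode_left, cueMoment1_const, hneg]
  unfold cueCumulant3
  simp only [hz, hy, hx, cueMoment2_const_mul, cueMoment2_expMode, cueMoment3_expMode, h111,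
    pairSum_neg, hneg]
  linear_combination (N : ℂ) ^ 3 * hδ

lemma thirdOrderSFF_eq (N : ℕ) (k : ℝ) (b : ℕ) :
    thirdOrderSFF N k b = 1 / (2 * (Real.pi : ℂ)) *
      (cycleSum N k b - pairSum N (k + b) - pairSum N b - pairSum N k + N) := by
  rw [← cueCumulant3_expMode]
  unfold thirdOrderSFF cueCumulant3AtZero
  congr 2
  funext x y z
  unfold expMode
  rw [← Complex.exp_add]
  push_cast
  ring_nf

/-! ### Collapse to rectangle sums. -/

/-- The only admissible m is n + b, which lies below N exactly when n < N - b. Truncated subtraction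
makes the range empty for b ≥ N. -/
lemma sum_sum_fin_ite_eq (N b : ℕ) (F : ℕ → ℂ) :
    ∑ m : Fin N, ∑ n : Fin N, (if (b : ℤ) + ((n : ℕ) - (m : ℕ) : ℤ) = 0 then F n else 0)
      = ∑ j ∈ Finset.range (N - b), F j := by
  rw [Finset.sum_comm, Fin.sum_univ_eq_sum_range (fun n => ∑ m : Fin N,
    (if (b : ℤ) + ((n : ℕ) - (m : ℕ) : ℤ) = 0 then F n else 0)) N]
  have : ∀ n, (∑ m : Fin N, (if (b : ℤ) + ((n : ℕ) - (m : ℕ) : ℤ) = 0 then F n else 0))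
      = if n < N - b then F n else 0 := fun n => by
    rw [Fin.sum_univ_eq_sum_range (fun m =>
      (if (b : ℤ) + ((n : ℕ) - (m : ℕ) : ℤ) = 0 then F n else 0)) N]
    have e : ∀ m : ℕ, ((b : ℤ) + ((n : ℕ) - (m : ℕ) : ℤ) = 0) ↔ n + b = m := fun m => by omega
    simp only [e, Finset.sum_ite_eq, Finset.mem_range]
    congr 1
    exact propext (by omega)
  simp only [this]
  rw [← Finset.sum_filter]
  congr 1
  ext n
  simp only [Finset.mem_filter, Finset.mem_range]
  omega

/-- The sum `∑ E(x + j - p)` over `0 ≤ j < M` and `0 ≤ p < N`. -/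
def boxSum (M N : ℕ) (x : ℝ) : ℂ :=
  ∑ j ∈ Finset.range M, ∑ p ∈ Finset.range N, modeMean (x + j - p)

lemma pairSum_eq_boxSum (N : ℕ) (κ : ℝ) : pairSum N κ = boxSum N N κ := by
  unfold pairSum boxSum
  rw [Fin.sum_univ_eq_sum_range (fun m => ∑ n : Fin N, modeMean (κ + ((m : ℕ) - (n : ℕ) : ℤ))) N]
  refine Finset.sum_congr rfl fun m _ => ?_
  rw [Fin.sum_univ_eq_sum_range (fun n => modeMean (κ + ((m : ℕ) - (n : ℕ) : ℤ))) N]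
  refine Finset.sum_congr rfl fun n _ => ?_
  push_cast
  ring_nf

lemma pairSum_nat (N b : ℕ) : pairSum N b = ((N - b : ℕ) : ℂ) := by
  unfold pairSum
  rw [Finset.sum_comm]
  simp only [modeMean_nat_add_int]
  rw [sum_sum_fin_ite_eq N b fun _ => 1]
  simp

lemma cycleSum_eq_boxSum (N : ℕ) (k : ℝ) (b : ℕ) :
    cycleSum N k b = boxSum (N - b) N (k + b) + boxSum N (N - b) k := by
  unfold cycleSum
  simp only [Finset.sum_add_distrib]
  congr 1
  · have h : ∀ m n : Fin N, ∑ p : Fin N, modeMean (b + ((n : ℕ) - (m : ℕ) : ℤ)) *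
        modeMean (k + ((m : ℕ) - (p : ℕ) : ℤ))
        = if (b : ℤ) + ((n : ℕ) - (m : ℕ) : ℤ) = 0 then
          ∑ p ∈ Finset.range N, modeMean (k + b + (n : ℕ) - p) else 0 := fun m n => by
      simp only [modeMean_nat_add_int]
      split_ifs with hc
      · rw [Fin.sum_univ_eq_sum_range
          (fun p => 1 * modeMean (k + ((m : ℕ) - (p : ℕ) : ℤ))) N]
        refine Finset.sum_congr rfl fun p _ => ?_
        rw [one_mul, show ((m : ℕ) : ℤ) = b + (n : ℕ) by linarith]
        push_cast
        ring_nf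
      · simp
    simp only [h]
    exact sum_sum_fin_ite_eq N b fun n => ∑ p ∈ Finset.range N, modeMean (k + b + (n : ℕ) - p)
  · unfold boxSum
    rw [Fin.sum_univ_eq_sum_range (fun m => ∑ n : Fin N, ∑ p : Fin N,
      modeMean (k + ((m : ℕ) - (n : ℕ) : ℤ)) * modeMean (b + ((n : ℕ) - (p : ℕ) : ℤ))) N]
    refine Finset.sum_congr rfl fun m _ => ?_
    rw [Finset.sum_comm, ← sum_sum_fin_ite_eq N b fun n => modeMean (k + m - n)]
    refine Finset.sum_congr rfl fun p _ => Finset.sum_congr rfl fun n _ => ?_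
    rw [modeMean_nat_add_int]
    split_ifs
    · push_cast
      ring_nf
    · simp

lemma re_thirdOrderSFF (N : ℕ) (k : ℝ) (b : ℕ) :
    (thirdOrderSFF N k b).re = 1 / (2 * Real.pi) *
      ((boxSum (N - b) N (k + b)).re + (boxSum N (N - b) k).re - (boxSum N N (k + b)).re
        - (boxSum N N k).re + ((N : ℝ) - (N - b : ℕ))) := by
  rw [thirdOrderSFF_eq, pairSum_nat, cycleSum_eq_boxSum, pairSum_eq_boxSum, pairSum_eq_boxSum,
    show 1 / (2 * (Real.pi : ℂ)) = ((1 / (2 * Real.pi) : ℝ) : ℂ) by push_cast; ring,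
    Complex.re_ofReal_mul]
  simp only [Complex.add_re, Complex.sub_re, Complex.natCast_re]
  ring

/-! ### Digamma summation. -/

lemma psi0_add_one {x : ℝ} (hx : ∀ m : ℤ, x ≠ m) : psi0 (x + 1) = psi0 x + 1 / x := by
  have hΓ : ∀ m : ℕ, x ≠ -m := fun m => by
    have := hx (-m)
    push_cast at this
    exact this
  have hx0 : x ≠ 0 := by simpa using hx 0
  have hd : DifferentiableAt ℝ (fun t => Real.log (Real.Gamma t)) x :=
    (Real.differentiableAt_Gamma hΓ).log (Real.Gamma_ne_zero hΓ)
  unfold psi0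
  rw [← deriv_comp_add_const (fun t => Real.log (Real.Gamma t)) 1 x]
  have hopen : ∀ᶠ t in 𝓝 x, Real.log (Real.Gamma (t + 1))
      = Real.log (Real.Gamma t) + Real.log t := by
    have h1 : ∀ᶠ t in 𝓝 x, t ≠ 0 := eventually_ne_nhds hx0
    have h2 : ∀ᶠ t in 𝓝 x, Real.Gamma t ≠ 0 :=
      (Real.differentiableAt_Gamma hΓ).continuousAt.eventually_ne (Real.Gamma_ne_zero hΓ)
    filter_upwards [h1, h2] with t ht1 ht2
    rw [Real.Gamma_add_one ht1, Real.log_mul ht1 ht2, add_comm]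
  rw [Filter.EventuallyEq.deriv_eq hopen, deriv_fun_add hd (Real.differentiableAt_log hx0), Real.deriv_log, one_div]

lemma sum_one_div_add {x : ℝ} (hx : ∀ m : ℤ, x ≠ m) (M : ℕ) :
    ∑ j ∈ Finset.range M, 1 / (x + j) = psi0 (x + M) - psi0 x := by
  induction M with
  | zero => simp
  | succ M ih =>
    have h : ∀ m : ℤ, x + M ≠ m := fun m hm => hx (m - M) (by push_cast; linarith)
    rw [Finset.sum_range_succ, ih]
    push_cast
    rw [← add_assoc, psi0_add_one h]
    ring

/-- With y = x - p the recurrence reads ψ₀(y) = y ψ₀(y + 1) - (y - 1) ψ₀(y) - 1, so the sum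
telescopes. -/
lemma sum_psi0_sub {x : ℝ} (hx : ∀ m : ℤ, x ≠ m) (N : ℕ) :
    ∑ p ∈ Finset.range N, psi0 (x - p)
      = x * psi0 (x + 1) - (x - N) * psi0 (x - N + 1) - N := by
  induction N with
  | zero => simp
  | succ N ih =>
    have h : ∀ m : ℤ, x - N ≠ m := fun m hm => hx (m + N) (by push_cast; linarith)
    have h0 : x - N ≠ 0 := by simpa using h 0
    rw [Finset.sum_range_succ, ih, psi0_add_one h]
    push_cast
    rw [show x - (N + 1 : ℝ) + 1 = x - N by ring]
    field_simp
    ring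

lemma sum_sum_one_div {x : ℝ} (hx : ∀ m : ℤ, x ≠ m) (M N : ℕ) :
    ∑ j ∈ Finset.range M, ∑ p ∈ Finset.range N, 1 / (x + j - p)
      = (x + M) * psi0 (x + M + 1) - x * psi0 (x + 1)
        - (x + M - N) * psi0 (x + M - N + 1) + (x - N) * psi0 (x - N + 1) := by
  rw [Finset.sum_comm]
  have h : ∀ p : ℕ, ∑ j ∈ Finset.range M, 1 / (x + j - p) = psi0 (x + M - p) - psi0 (x - p) := by
    intro p
    have hp : ∀ m : ℤ, x - p ≠ m := fun m hm => hx (m + p) (by push_cast; linarith)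
    rw [show x + M - p = x - p + M by ring, ← sum_one_div_add hp]
    refine Finset.sum_congr rfl fun j _ => ?_
    congr 1
    ring
  have hM : ∀ m : ℤ, x + M ≠ m := fun m hm => hx (m - M) (by push_cast; linarith)
  simp only [h]
  rw [Finset.sum_sub_distrib, sum_psi0_sub hx, sum_psi0_sub hM]
  ring

/-! ### Real parts, continuity and the closed form. -/

lemma re_boxSum (M N : ℕ) (x : ℝ) : (boxSum M N x).re
    = ∑ j ∈ Finset.range M, ∑ p ∈ Finset.range N, Real.sinc (2 * Real.pi * (x + j - p)) := by
  unfold boxSum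
  simp only [Complex.re_sum, re_modeMean]

lemma sin_two_pi_mul_add_sub (x : ℝ) (j p : ℕ) :
    Real.sin (2 * Real.pi * (x + j - p)) = Real.sin (2 * Real.pi * x) := by
  have := Real.sin_add_int_mul_two_pi (2 * Real.pi * x) ((j : ℤ) - p)
  rw [← this]
  congr 1
  push_cast
  ring

lemma re_boxSum_of_ne_int {x : ℝ} (hx : ∀ m : ℤ, x ≠ m) (M N : ℕ) : (boxSum M N x).re
    = Real.sin (2 * Real.pi * x) / (2 * Real.pi) *
      ((x + M) * psi0 (x + M + 1) - x * psi0 (x + 1)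
        - (x + M - N) * psi0 (x + M - N + 1) + (x - N) * psi0 (x - N + 1)) := by
  rw [re_boxSum, ← sum_sum_one_div hx]
  simp only [Finset.mul_sum]
  refine Finset.sum_congr rfl fun j _ => Finset.sum_congr rfl fun p _ => ?_
  have h : x + j - p ≠ 0 := fun h => hx (p - j) (by push_cast; linarith)
  have hpi := Real.pi_ne_zero
  rw [Real.sinc_of_ne_zero (by positivity), sin_two_pi_mul_add_sub]
  field_simp

/-- Since p < N ≤ m, every m + j - p is a positive integer, and sinc vanishes at nonzero multiples
of 2π. -/
lemma re_boxSum_int {m : ℤ} (M : ℕ) {N : ℕ} (h : (N : ℤ) ≤ m) : (boxSum M N m).re = 0 := by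
  rw [re_boxSum]
  refine Finset.sum_eq_zero fun j _ => Finset.sum_eq_zero fun p hp => ?_
  have hp' : (p : ℝ) < N := by exact_mod_cast Finset.mem_range.mp hp
  have hm : (N : ℝ) ≤ m := by exact_mod_cast h
  have hj : (0 : ℝ) ≤ j := j.cast_nonneg
  have h0 : (m : ℝ) + j - p ≠ 0 := by linarith
  have hpi := Real.pi_ne_zero
  rw [Real.sinc_of_ne_zero (by positivity), sin_two_pi_mul_add_sub,
    show 2 * Real.pi * m = 0 + m * (2 * Real.pi) by ring, Real.sin_add_int_mul_two_pi]
  simp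

lemma continuous_re_boxSum (M N : ℕ) : Continuous fun x => (boxSum M N x).re := by
  simp only [re_boxSum]
  have := Real.continuous_sinc
  fun_prop

lemma continuous_re_thirdOrderSFF (N b : ℕ) : Continuous fun k => (thirdOrderSFF N k b).re := by
  simp only [re_thirdOrderSFF]
  have h1 := continuous_re_boxSum (N - b) N
  have h2 := continuous_re_boxSum N (N - b)
  have h3 := continuous_re_boxSum N N
  have h4 : Continuous fun k : ℝ => k + b := by fun_prop
  exact continuous_const.mul (((((h1.comp h4).add h2).sub (h3.comp h4)).sub h3).add
    continuous_const)

lemma natCast_sub_eq_max (N b : ℕ) : ((N - b : ℕ) : ℝ) = max 0 ((N : ℝ) - b) := by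
  rcases le_total b N with h | h
  · have : (b : ℝ) ≤ N := by exact_mod_cast h
    rw [Nat.cast_sub h, max_eq_right (by linarith)]
  · have : (N : ℝ) ≤ b := by exact_mod_cast h
    rw [Nat.sub_eq_zero_of_le h, max_eq_left (by linarith), Nat.cast_zero]

lemma re_thirdOrderSFF_of_ne_int (N b : ℕ) {k : ℝ} (hk : ∀ m : ℤ, k ≠ m) :
    (thirdOrderSFF N k b).re = thirdOrderClosedForm N b k := by
  have hkb : ∀ m : ℤ, k + b ≠ m := fun m hm => hk (m - b) (by push_cast; linarith)
  have hsin : Real.sin (2 * Real.pi * (k + b)) = Real.sin (2 * Real.pi * k) := by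
    simpa using sin_two_pi_mul_add_sub k b 0
  have hpi := Real.pi_ne_zero
  rw [re_thirdOrderSFF, natCast_sub_eq_max]
  simp only [re_boxSum_of_ne_int hk, re_boxSum_of_ne_int hkb, hsin, natCast_sub_eq_max]
  unfold thirdOrderClosedForm unitStep
  -- For integers, b < N is the condition b ≤ N - 1 under which the unit step is 1. Otherwise the
  -- two rectangles of side N - b are empty.
  rcases lt_or_ge b N with h | h
  · have h' : (b : ℝ) + 1 ≤ N := by exact_mod_cast h
    rw [max_eq_right (by linarith), if_pos (by linarith)]
    rw [show k + b + ((N : ℝ) - b) = k + N by ring, show k + (N : ℝ) - N = k by ring,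
      show k + (N : ℝ) - ((N : ℝ) - b) = b + k by ring, show k - ((N : ℝ) - b) = b + k - N by ring,
      show k + b + N - (N : ℝ) = b + k by ring, add_comm k (b : ℝ)]
    field_simp
    ring
  · have h' : (N : ℝ) ≤ b := by exact_mod_cast h
    rw [max_eq_left (by linarith), if_neg (by linarith)]
    rw [show k + (N : ℝ) - N = k by ring, show k + b + N - (N : ℝ) = b + k by ring,
      add_comm k (b : ℝ)]
    simp only [add_zero, sub_zero]
    field_simp
    ring

/-- The sine prefactor vanishes, so no digamma value matters; all four rectangle sums vanish too,
leaving the constant term. -/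
lemma re_thirdOrderSFF_int {N : ℕ} (b : ℕ) {m : ℤ} (hm : (N : ℤ) ≤ m) :
    (thirdOrderSFF N m b).re = thirdOrderClosedForm N b m := by
  have hb : (m : ℝ) + b = ((m + b : ℤ) : ℝ) := by push_cast; ring
  have hsin : Real.sin (2 * Real.pi * m) = 0 := by
    rw [show 2 * Real.pi * m = 0 + m * (2 * Real.pi) by ring, Real.sin_add_int_mul_two_pi,
      Real.sin_zero]
  unfold thirdOrderClosedForm
  rw [re_thirdOrderSFF, hb, re_boxSum_int _ (by omega), re_boxSum_int _ (by omega),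
    re_boxSum_int _ (by omega), re_boxSum_int _ hm, natCast_sub_eq_max, hsin]
  ring

/-- The interval from ⌈k⌉ - 1 to ⌊k⌋ + 1 contains k and no integer other than possibly k itself. -/
lemma eventually_ne_int (k : ℝ) : ∀ᶠ x in 𝓝[≠] k, ∀ m : ℤ, x ≠ (m : ℝ) := by
  have h : ∀ᶠ x in 𝓝[≠] k, x ∈ Set.Ioo ((⌈k⌉ : ℝ) - 1) ((⌊k⌋ : ℝ) + 1) :=
    mem_nhdsWithin_of_mem_nhds (Ioo_mem_nhds (by linarith [Int.ceil_lt_add_one k])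
      (Int.lt_floor_add_one k))
  filter_upwards [h, self_mem_nhdsWithin] with x hx hne m hm
  rw [hm] at hx
  have h1 : ⌈k⌉ - 1 < m := by exact_mod_cast hx.1
  have h2 : m < ⌊k⌋ + 1 := by exact_mod_cast hx.2
  have h3 : k ≤ m := (Int.le_ceil k).trans (by exact_mod_cast (by omega : ⌈k⌉ ≤ m))
  have h4 : (m : ℝ) ≤ k := le_trans (by exact_mod_cast (by omega : m ≤ ⌊k⌋)) (Int.floor_le k)
  exact hne (hm.trans (le_antisymm h4 h3))

end

/-- The real part of the third-order spectral form factor of the circular unitary ensemble.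
The arguments of `ψ₀` in the closed form avoid the poles `0, -1, -2, …` unless `k` is an integer
smaller than `N`; at these integers the singularity is removable and the closed form is read as
its limit. -/
theorem proposition3 (N : ℕ) (hN : 1 ≤ N) (b : ℕ) (k : ℝ) :
    ((∀ m : ℤ, k = (m : ℝ) → (N : ℤ) ≤ m) →
      (thirdOrderSFF N k b).re = thirdOrderClosedForm N b k) ∧
    Tendsto (fun x : ℝ => thirdOrderClosedForm N b x) (𝓝[≠] k)
      (𝓝 (thirdOrderSFF N k b).re) := by
  constructor
  · intro h
    by_cases hk : ∀ m : ℤ, k ≠ m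
    · exact re_thirdOrderSFF_of_ne_int N b hk
    · push Not at hk
      obtain ⟨m, rfl⟩ := hk
      exact re_thirdOrderSFF_int b (h m rfl)
  · have hc : Tendsto (fun x => (thirdOrderSFF N x b).re) (𝓝[≠] k)
        (𝓝 (thirdOrderSFF N k b).re) :=
      (continuous_re_thirdOrderSFF N b).continuousAt.mono_left nhdsWithin_le_nhds
    refine hc.congr' ?_
    filter_upwards [eventually_ne_int k] with x hx
    exact re_thirdOrderSFF_of_ne_int N b hx
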